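/- Let $K$ be a $3$-adic field (a finite extension of $\mathbb{Q}_3$) with ring of integers $\mathcal{O}_K$, maximal ideal $\mathfrak{m}$, residue field of order $q$, and $3\mathcal{O}_K = \mathfrak{m}^{e}$. Let $L$ be a cubic étale algebra over $K$, with integral closure $\mathcal{O}_L$ of $\mathcal{O}_K$, whose discriminant ideal is $\mathfrak{m}^{d_0}$. An order of $L$ is a subring $\mathcal{O}\supseteq\mathcal{O}_K$ of $L$ that is a finitely generated $\mathcal{O}_K$-module and spans $L$ over $K$; it is called $\mathfrak{m}^t$-traced if $\operatorname{tr}(\mathcal{O}) \subseteq \mathfrak{m}^t$. The splitting type $\sigma(L)$ records the pairs (ramification index, residue degree) of the primes of $\mathcal{O}_L$ above $\mathfrak{m}$: $1^3$ means $\{(3,1)\}$; $1^21$ means $\{(2,1),(1,1)\}$; $3$ means $\{(1,3)\}$; $12$ means $\{(1,1),(1,2)\}$; $111$ means $\{(1,1),(1,1),(1,1)\}$. Let $d$ and $t$ be integers with $d \ge d_0$, $d \equiv d_0 \pmod 2$ and $0 \le t \le e$. Then the number $g(L,d,t)$ of $\mathfrak{m}^t$-traced orders of $L$ with discriminant ideal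 $\mathfrak{m}^d$ is finite, and it is given as follows. Put $$g^{1^3} = \frac{q^r-1}{q-1},\qquad r = \begin{cases} 0, & d < 3t\\ \lfloor d/3\rfloor - t + 1, & 3t \le d \le 6t-d_0\\ \lfloor (d-d_0)/6\rfloor + 1, & d \ge 3t \text{ and } d \ge 6t-d_0;\end{cases}$$ $$g^{3} = \frac{q^r-1}{q-1},\qquad r = \begin{cases} 0, & d < 3t\\ \lfloor d/3\rfloor - t + 1, & 3t \le d \le 6t\\ d/2 - 2\lceil d/6\rceil + 1, & d \ge 6t\end{cases}\qquad (d_0=0);$$ $$g^{\mathrm{SR}} = \frac{q^r-q^t}{q-1},\qquad r = \begin{cases} t, & d < 6t\\ \lfloor (d+4)/6\rfloor, & d \ge 6t\end{cases}\qquad (d_0\in\{0,1\}).$$ Then - if $\sigma(L) = 1^3$, then $g(L,d,t) = g^{1^3}$; - if $\sigma(L) = 1^21$, then $g(L,d,t) = g^{1^3} + g^{\mathrm{SR}}$; - if $\sigma(L) = 3$, then $g(L,d,t) = g^{3}$; - if $\sigma(L) = 12$, then $g(L,d,t) = g^{3} + g^{\mathrm{SR}}$; - if $\sigma(L) = 111$,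 then $g(L,d,t) = g^{3} + 3g^{\mathrm{SR}}$. -/

import Mathlib

open scoped ValuativeRel

/-- The discriminant ideal of a cubic `A`-algebra `B`: the ideal of `A` generated by the
discriminants `det (tr (b i * b j))` of all triples of elements of `B`.  If `B` is free of rank `3`
over `A`, this is the principal ideal generated by the discriminant of any `A`-basis of `B`. -/
def cubicDiscIdeal (A B : Type*) [CommRing A] [CommRing B] [Algebra A B] : Ideal A :=
  Ideal.span (Set.range fun b : Fin 3 → B => Algebra.discr A b)

/-- The trace ideal of `B` over `A`: the image of the trace map `B → A`. -/
noncomputable def traceIdeal (A B : Type*) [CommRing A] [CommRing B] [Algebra A B] : Ideal A :=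
  LinearMap.range (Algebra.trace A B)

/-- The set of orders `O` of the `K`-algebra `L` over `A` (subrings of `L` containing `A` which are
finitely generated as `A`-modules and span `L` over `K`) whose discriminant ideal is `D` and
which are `T`-traced, i.e. the trace ideal of `O` is contained in `T`. -/
def tracedOrders (A K L : Type*) [CommRing A] [Field K] [Algebra A K] [CommRing L]
    [Algebra K L] [Algebra A L] [IsScalarTower A K L] (D T : Ideal A) : Set (Subalgebra A L) :=
  {O | Submodule.IsLattice K (Subalgebra.toSubmodule O) ∧
    cubicDiscIdeal A O = D ∧ traceIdeal A O ≤ T}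

/-- The five splitting types of a cubic étale algebra over a local field. -/
inductive CubicSplittingType : Type
  /-- `1³` -/
  | totRam
  /-- `1²1` -/
  | partRam
  /-- `3` -/
  | inert
  /-- `12` -/
  | partSplit
  /-- `111` -/
  | split

/-- The pairs (ramification index, residue degree) of the primes, in each splitting type. -/
def CubicSplittingType.pattern : CubicSplittingType → List (ℕ × ℕ)
  | .totRam => [(3, 1)]
  | .partRam => [(2, 1), (1, 1)]
  | .inert => [(1, 3)]
  | .partSplit => [(1, 1), (1, 2)]
  | .split => [(1, 1), (1, 1), (1, 1)]

/-- `L` has splitting type `σ` over the local ring `A`: the prime ideals of the integral closure of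
`A` in `L` lying over the maximal ideal of `A` can be enumerated without repetition so that their
ramification indices and residue degrees are those listed in `σ.pattern`. -/
def HasSplittingType (A L : Type*) [CommRing A] [IsLocalRing A] [CommRing L] [Algebra A L]
    (σ : CubicSplittingType) : Prop :=
  ∃ P : Fin σ.pattern.length ≃
      ((IsLocalRing.maximalIdeal A).primesOver (integralClosure A L)),
    ∀ i, ((P i).1.ramificationIdx A, (P i).1.inertiaDeg A) = σ.pattern.get i

/-- The exponent `r` in `gTotRam`: `0` if `d < 3t`, `⌊d/3⌋ - t + 1` if `3t ≤ d ≤ 6t - d₀`, and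
`⌊(d - d₀)/6⌋ + 1` if `d ≥ 6t - d₀`.  Division in `ℕ` rounds down; no subtraction is truncated
when `d₀ ≤ d`. -/
def rTotRam (d₀ d t : ℕ) : ℕ :=
  if d < 3 * t then 0
  else if d + d₀ ≤ 6 * t then d / 3 - t + 1
  else (d - d₀) / 6 + 1

/-- The function `g^{1³}(d₀, d, t) = (q ^ r - 1) / (q - 1)`. -/
def gTotRam (q d₀ d t : ℕ) : ℚ := ((q : ℚ) ^ rTotRam d₀ d t - 1) / ((q : ℚ) - 1)

/-- The exponent `r` in `gInert`: `0` if `d < 3t`, `⌊d/3⌋ - t + 1` if `3t ≤ d ≤ 6t`, and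
`d/2 - 2⌈d/6⌉ + 1` if `d ≥ 6t`.  Here `d` is even, `⌈d/6⌉` is `(d + 5) / 6`, and no subtraction is
truncated. -/
def rInert (d t : ℕ) : ℕ :=
  if d < 3 * t then 0
  else if d ≤ 6 * t then d / 3 - t + 1
  else d / 2 + 1 - 2 * ((d + 5) / 6)

/-- The function `g^3(d, t) = (q ^ r - 1) / (q - 1)`. -/
def gInert (q d t : ℕ) : ℚ := ((q : ℚ) ^ rInert d t - 1) / ((q : ℚ) - 1)

/-- The exponent `r` in `gSR`: `t` if `d < 6t`, and `⌊(d + 4)/6⌋` if `d ≥ 6t`. -/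
def rSR (d t : ℕ) : ℕ := if d < 6 * t then t else (d + 4) / 6

/-- The function `g^{SR}(d, t) = (q ^ r - q ^ t) / (q - 1)`. -/
def gSR (q d t : ℕ) : ℚ := ((q : ℚ) ^ rSR d t - (q : ℚ) ^ t) / ((q : ℚ) - 1)

/-- The value of the traced order count in each splitting type. -/
def tracedOrderCount (q d₀ d t : ℕ) : CubicSplittingType → ℚ
  | .totRam => gTotRam q d₀ d t
  | .partRam => gTotRam q d₀ d t + gSR q d t
  | .inert => gInert q d t
  | .partSplit => gInert q d t + gSR q d t
  | .split => gInert q d t + 3 * gSR q d t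

/-! Cubic rings are encoded by binary cubic forms. Let `A` be the valuation ring, `p` a uniformizer
and `f = (a, b, c, d)` the index form of the maximal order in a basis `1, ω, θ` with `ω θ ∈ A`.
Hermite reduction writes every order as `⟨1, p^j ω, u ω + p^i θ⟩`, with `i`, `j` and `u` modulo
`p^j` uniquely determined, and the discriminant fixes `n = i + j`. Closure under multiplication
becomes a list of divisibilities, chiefly `p^(i+j) ∣ f(u, p^i)` (`mul_mem_hermiteLattice_iff`);
being traced becomes `p^t ∣ b p^j` and `p^t ∣ b u - c p^i` (`traceIdeal_le_iff`). The count is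
therefore a sum over `j` of numbers of residue classes of `u` (`ncard_tracedOrders`).

Maximality and residue characteristic 3 leave two normal forms (`exists_normalForm`). If `f` modulo
`p` is not a multiple of a cube, one may take `c` a unit, `3 ∣ b` and `v(a) = d₀ ≤ 1`. For `j ≤ 2i`
the solutions `u` are the multiples of one power of `p`, or there are none, and a geometric sum
gives `g^3` or `g^{1³}`. For `j > 2i` one has `u = p^i z` with `f(z, 1)` divisible by a power of
`p`; by Hensel's lemma each root of `f(z, 1)` modulo `p` contributes one copy of `g^SR`.

If `f` is a unit times a cube modulo `p`, it can be put in Eisenstein position. Then `f(u, p^i)` has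
valuation `min(3 v(u), 3i + 1)`, and only one geometric sum occurs. The trace condition now involves
both `b` and `c`; since `b + 2b = 3b`, a shear makes one of them divisible by `p^t`
(`exists_isTotRamForm_dvd`). The other one is divisible by `p^t` as well, or has a valuation `g`
that can be read off from `d₀`, which is `3g` or `3g + 1`.

The splitting type is matched with the form by counting homomorphisms from the maximal order to the
residue field: they correspond to the primes of degree one (`card_algHom_residueField`) and to the
solutions of the multiplication table modulo `p`. When this count cannot tell `1³` from `12`, a
trace argument does (`ne_totRam`). -/

/-- The elements `ω`, `θ` of `L`, together with `1`, form an `A`-basis of the integral closure of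
`A` in `L`, and their multiplication table is the Delone–Faddeev table of the binary cubic form
`a x ^ 3 + b x ^ 2 y + c x y ^ 2 + d y ^ 3`. -/
structure IsIndexFormBasis {A L : Type*} [CommRing A] [CommRing L] [Algebra A L]
    (a b c d : A) (ω θ : L) : Prop where
  fst_sq : ω * ω = algebraMap A L (-(a * c)) + algebraMap A L b * ω - algebraMap A L a * θ
  fst_mul_snd : ω * θ = algebraMap A L (-(a * d))
  snd_sq : θ * θ = algebraMap A L (-(b * d)) + algebraMap A L d * ω - algebraMap A L c * θ
  indep : ∀ r x y : A, algebraMap A L r + algebraMap A L x * ω + algebraMap A L y * θ = 0 →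
    r = 0 ∧ x = 0 ∧ y = 0
  exists_eq : ∀ z : L, IsIntegral A z →
    ∃ r x y : A, z = algebraMap A L r + algebraMap A L x * ω + algebraMap A L y * θ

/-- The discriminant of a binary cubic form. -/
def cubicFormDisc {A : Type*} [CommRing A] (a b c d : A) : A :=
  b ^ 2 * c ^ 2 - 4 * a * c ^ 3 - 4 * b ^ 3 * d - 27 * a ^ 2 * d ^ 2 + 18 * a * b * c * d

/-! ### Substitutions in the index form, and maximality -/

namespace IsIndexFormBasis

section Ring

variable {A L : Type*} [CommRing A] [CommRing L] [Algebra A L] {a b c d : A} {ω θ : L}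

/-- Exchanging the generators replaces `f(x, y)` by `-f(y, x)`, so facts about `a`, `b` transfer to
`d`, `c`. -/
lemma swap (h : IsIndexFormBasis a b c d ω θ) : IsIndexFormBasis (-d) (-c) (-b) (-a) θ ω where
  fst_sq := by rw [h.snd_sq]; simp only [map_neg, map_mul]; ring
  fst_mul_snd := by rw [mul_comm, h.fst_mul_snd]; simp only [map_neg, map_mul]; ring
  snd_sq := by rw [h.fst_sq]; simp only [map_neg, map_mul]; ring
  indep r x y hz := by
    obtain ⟨h1, h2, h3⟩ := h.indep r y x (by linear_combination hz)
    exact ⟨h1, h3, h2⟩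
  exists_eq z hz := by
    obtain ⟨r, x, y, h⟩ := h.exists_eq z hz
    exact ⟨r, y, x, by rw [h]; ring⟩

/-- This is the substitution `f(x, y + μ x)`. The constants added to the generators bring their
product back into `A`. -/
lemma shear (h : IsIndexFormBasis a b c d ω θ) (μ : A) :
    IsIndexFormBasis (a + b * μ + c * μ ^ 2 + d * μ ^ 3) (b + 2 * c * μ + 3 * d * μ ^ 2)
      (c + 3 * d * μ) d
      (ω + algebraMap A L μ * θ + algebraMap A L (μ * c + μ ^ 2 * d))
      (θ - algebraMap A L (μ * d)) where
  fst_sq := by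
    have h1 := h.fst_sq
    have h2 := h.fst_mul_snd
    have h3 := h.snd_sq
    simp only [map_neg, map_mul, map_add, map_pow, map_ofNat] at *
    linear_combination h1 + 2 * algebraMap A L μ * h2 + algebraMap A L μ ^ 2 * h3
  fst_mul_snd := by
    have h2 := h.fst_mul_snd
    have h3 := h.snd_sq
    simp only [map_neg, map_mul, map_add, map_pow] at *
    linear_combination h2 + algebraMap A L μ * h3
  snd_sq := by
    have h3 := h.snd_sq
    simp only [map_neg, map_mul, map_add, map_pow, map_ofNat] at *
    linear_combination h3
  indep r x y hz := by
    obtain ⟨h1, h2, h3⟩ := h.indep (r + x * (μ * c + μ ^ 2 * d) - y * (μ * d)) x (x * μ + y) (by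
      simp only [map_mul, map_add, map_pow, map_sub] at *
      linear_combination hz)
    subst h2
    have hy : y = 0 := by simpa using h3
    subst hy
    exact ⟨by simpa using h1, rfl, rfl⟩
  exists_eq z hz := by
    obtain ⟨r, x, y, h⟩ := h.exists_eq z hz
    refine ⟨r - x * (μ * c + μ ^ 2 * d) + (y - x * μ) * (μ * d), x, y - x * μ, ?_⟩
    rw [h]
    simp only [map_mul, map_add, map_pow, map_sub]
    ring

/-- The transposed shear, replacing the form `f(x, y)` by `f(x + λ y, y)`. -/
lemma exists_shear' (h : IsIndexFormBasis a b c d ω θ) (μ : A) :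
    ∃ ω' θ' : L, IsIndexFormBasis a (b + 3 * a * μ) (c + 2 * b * μ + 3 * a * μ ^ 2)
      (d + c * μ + b * μ ^ 2 + a * μ ^ 3) ω' θ' := by
  have h' := ((h.swap).shear μ).swap
  refine ⟨_, _, (?_ : IsIndexFormBasis _ _ _ _
    (ω - algebraMap A L (μ * -a))
    (θ + algebraMap A L μ * ω + algebraMap A L (μ * -b + μ ^ 2 * -a)))⟩
  convert h' using 1 <;> ring

lemma fst_cubic (h : IsIndexFormBasis a b c d ω θ) :
    ω ^ 3 - algebraMap A L b * ω ^ 2 + algebraMap A L (a * c) * ω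
      - algebraMap A L (a ^ 2 * d) = 0 := by
  have h1 := h.fst_sq
  have h2 := h.fst_mul_snd
  simp only [map_neg, map_mul, map_pow] at *
  linear_combination ω * h1 - algebraMap A L a * h2

lemma isIntegral_fst (h : IsIndexFormBasis a b c d ω θ) : IsIntegral A ω := by
  refine ⟨Polynomial.X ^ 3 - Polynomial.C b * Polynomial.X ^ 2 +
    Polynomial.C (a * c) * Polynomial.X - Polynomial.C (a ^ 2 * d), by monicity!, ?_⟩
  simpa using h.fst_cubic

lemma isIntegral_snd (h : IsIndexFormBasis a b c d ω θ) : IsIntegral A θ := h.swap.isIntegral_fst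

lemma comb_injective (h : IsIndexFormBasis a b c d ω θ) {r x y r' x' y' : A}
    (e : algebraMap A L r + algebraMap A L x * ω + algebraMap A L y * θ =
      algebraMap A L r' + algebraMap A L x' * ω + algebraMap A L y' * θ) :
    r = r' ∧ x = x' ∧ y = y' := by
  obtain ⟨h1, h2, h3⟩ := h.indep (r - r') (x - x') (y - y') (by
    simp only [map_sub]; linear_combination e)
  exact ⟨sub_eq_zero.1 h1, sub_eq_zero.1 h2, sub_eq_zero.1 h3⟩

lemma comb_mul_comb (h : IsIndexFormBasis a b c d ω θ) (r x y r' x' y' : A) :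
    (algebraMap A L r + algebraMap A L x * ω + algebraMap A L y * θ) *
      (algebraMap A L r' + algebraMap A L x' * ω + algebraMap A L y' * θ) =
    algebraMap A L (r * r' - a * c * (x * x') - a * d * (x * y' + y * x') - b * d * (y * y')) +
      algebraMap A L (r * x' + x * r' + b * (x * x') + d * (y * y')) * ω +
      algebraMap A L (r * y' + y * r' - a * (x * x') - c * (y * y')) * θ := by
  have h1 := h.fst_sq
  have h2 := h.fst_mul_snd
  have h3 := h.snd_sq
  simp only [map_neg, map_mul, map_add, map_sub] at *
  linear_combination algebraMap A L x * algebraMap A L x' * h1 +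
    (algebraMap A L x * algebraMap A L y' + algebraMap A L y * algebraMap A L x') * h2 +
    algebraMap A L y * algebraMap A L y' * h3

/-- The integral closure is a maximal ring. -/
lemma not_dvd [IsDomain A] (h : IsIndexFormBasis a b c d ω θ) {K : Type*} [Field K] [Algebra A K]
    [IsFractionRing A K] [Algebra K L] [IsScalarTower A K L] {p : A} (hp : Prime p)
    (hb : p ∣ b) (hac : p ^ 2 ∣ a * c) (had : p ^ 3 ∣ a ^ 2 * d) : False := by
  obtain ⟨b', rfl⟩ := hb
  obtain ⟨s, hs⟩ := hac
  obtain ⟨r, hr⟩ := had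
  have hpK : algebraMap A K p ≠ 0 := by
    simpa using hp.ne_zero
  set w : L := algebraMap K L (algebraMap A K p)⁻¹ * ω with hw
  have hpi : algebraMap A L p * algebraMap K L (algebraMap A K p)⁻¹ = 1 := by
    rw [IsScalarTower.algebraMap_apply A K L, ← map_mul, mul_inv_cancel₀ hpK, map_one]
  -- Dividing the cubic equation of `ω` by `p³` gives a monic equation for `ω / p` with coefficients
  -- `b / p`, `a c / p²` and `a² d / p³`, all in `A` by assumption.
  have hint : IsIntegral A w := by
    refine ⟨Polynomial.X ^ 3 - Polynomial.C b' * Polynomial.X ^ 2 +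
      Polynomial.C s * Polynomial.X - Polynomial.C r, by monicity!, ?_⟩
    have h1 := h.fst_cubic
    rw [hs, hr] at h1
    simp only [map_mul, map_pow] at h1
    simp only [Polynomial.eval₂_sub, Polynomial.eval₂_add, Polynomial.eval₂_mul,
      Polynomial.eval₂_pow, Polynomial.eval₂_X, Polynomial.eval₂_C, hw]
    generalize algebraMap K L (algebraMap A K p)⁻¹ = i at *
    generalize algebraMap A L p = P at *
    have e2 : i ^ 2 = P * i ^ 3 := by linear_combination (-i ^ 2) * hpi
    have e1 : i  = P ^ 2 * i ^ 3 := by linear_combination (-i - P * i ^ 2) * hpi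
    have e0 : 1  = P ^ 3 * i ^ 3 := by linear_combination (-1 - P * i - P ^ 2 * i ^ 2) * hpi
    linear_combination i ^ 3 * h1 - algebraMap A L b' * ω ^ 2 * e2 + algebraMap A L s * ω * e1
      - algebraMap A L r * e0
  obtain ⟨r', x, y, hz⟩ := h.exists_eq w hint
  have : algebraMap A L 0 + algebraMap A L 1 * ω + algebraMap A L 0 * θ =
      algebraMap A L (p * r') + algebraMap A L (p * x) * ω + algebraMap A L (p * y) * θ := by
    simp only [map_mul, map_zero, map_one]
    linear_combination algebraMap A L p * hz - ω * hpi
  exact hp.not_isUnit (IsUnit.of_mul_eq_one x (h.comb_injective this).2.1.symm)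

end Ring

end IsIndexFormBasis

/-! ### Traces and discriminants over `A` and over `K` -/

lemma cubicDiscIdeal_eq_span {A S : Type*} [CommRing A] [CommRing S] [Algebra A S]
    (v : Module.Basis (Fin 3) A S) : cubicDiscIdeal A S = Ideal.span {Algebra.discr A v} := by
  refine le_antisymm (Ideal.span_le.2 ?_) (Ideal.span_mono ?_)
  · rintro _ ⟨w, rfl⟩
    have hw : w = ((Matrix.of fun i j => v.repr (w i) j).map (algebraMap A S)).mulVec v := by
      funext i
      conv_lhs => rw [← v.sum_repr (w i)]
      simp [Matrix.mulVec, dotProduct, Algebra.smul_def]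
    simp only [SetLike.mem_coe, Ideal.mem_span_singleton]
    rw [hw, Algebra.discr_of_matrix_mulVec]
    exact dvd_mul_left _ _
  · rintro _ rfl
    exact ⟨v, rfl⟩

section FractionField

variable {A K L : Type*} [CommRing A] [Field K] [Algebra A K] [IsFractionRing A K]
  [CommRing L] [Algebra K L] [Algebra A L] [IsScalarTower A K L]

/-- An `A`-linearly independent triple in a three-dimensional space is a basis over `K`. -/
noncomputable def basisOfTriple (hL : Module.finrank K L = 3) {v : Fin 3 → L}
    (hv : LinearIndependent A v) : Module.Basis (Fin 3) K L :=
  basisOfLinearIndependentOfCardEqFinrank ((LinearIndependent.iff_fractionRing A K).1 hv)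
    (by simp [hL])

@[simp] lemma coe_basisOfTriple (hL : Module.finrank K L = 3) {v : Fin 3 → L}
    (hv : LinearIndependent A v) : ⇑(basisOfTriple hL hv) = v := by
  simp [basisOfTriple]

lemma linearIndependent_coe_basis {O : Subalgebra A L} (v : Module.Basis (Fin 3) A O) :
    LinearIndependent A (fun i => (v i : L)) :=
  v.linearIndependent.map' O.val.toLinearMap (LinearMap.ker_eq_bot.2 Subtype.val_injective)

lemma repr_basisOfTriple (hL : Module.finrank K L = 3) {O : Subalgebra A L}
    (v : Module.Basis (Fin 3) A O) (x : O) (i : Fin 3) :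
    (basisOfTriple hL (linearIndependent_coe_basis v)).repr (x : L) i =
      algebraMap A K (v.repr x i) := by
  have : (x : L) = ∑ j, algebraMap A K (v.repr x j) •
      basisOfTriple hL (linearIndependent_coe_basis v) j := by
    conv_lhs => rw [← v.sum_repr x]
    simp only [coe_basisOfTriple, algebraMap_smul]
    exact map_sum O.val (fun j => v.repr x j • v j) Finset.univ
  rw [this, Module.Basis.repr_sum_self]

lemma algebraMap_trace_subalgebra (hL : Module.finrank K L = 3) {O : Subalgebra A L}
    (v : Module.Basis (Fin 3) A O) (x : O) :
    algebraMap A K (Algebra.trace A O x) = Algebra.trace K L x := by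
  rw [Algebra.trace_eq_matrix_trace v,
    Algebra.trace_eq_matrix_trace (basisOfTriple hL (linearIndependent_coe_basis v))]
  simp only [Matrix.trace, Matrix.diag_apply, Algebra.leftMulMatrix_eq_repr_mul,
    coe_basisOfTriple, map_sum]
  refine Finset.sum_congr rfl fun i _ => ?_
  rw [← Subalgebra.coe_mul, repr_basisOfTriple]

lemma algebraMap_discr_subalgebra (hL : Module.finrank K L = 3) {O : Subalgebra A L}
    (v : Module.Basis (Fin 3) A O) (w : Fin 3 → O) :
    algebraMap A K (Algebra.discr A w) = Algebra.discr K (fun i => (w i : L)) := by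
  rw [Algebra.discr_def, Algebra.discr_def, RingHom.map_det]
  congr 1
  ext i j
  simp [Algebra.traceMatrix_apply, Algebra.traceForm_apply, algebraMap_trace_subalgebra hL v]

lemma exists_basis_subalgebra {O : Subalgebra A L} {v : Fin 3 → L} (hv : LinearIndependent A v)
    (hO : Submodule.span A (Set.range v) = Subalgebra.toSubmodule O) :
    ∃ w : Module.Basis (Fin 3) A O, ∀ i, (w i : L) = v i :=
  ⟨(Module.Basis.span hv).map (LinearEquiv.ofEq _ _ hO), fun i => by
    simp only [Module.Basis.map_apply]
    exact Module.Basis.coe_span_apply hv i⟩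

end FractionField

namespace IsIndexFormBasis

variable {A K L : Type*} [CommRing A] [Field K] [Algebra A K] [IsFractionRing A K]
  [CommRing L] [Algebra K L] [Algebra A L] [IsScalarTower A K L] {a b c d : A} {ω θ : L}

lemma linearIndependent (h : IsIndexFormBasis a b c d ω θ) : LinearIndependent A ![1, ω, θ] := by
  rw [Fintype.linearIndependent_iff]
  intro g hg
  simp only [Fin.sum_univ_three, Matrix.cons_val, Algebra.smul_def, mul_one] at hg
  obtain ⟨h1, h2, h3⟩ := h.indep _ _ _ hg
  intro i
  fin_cases i <;> assumption

lemma repr_comb (hL : Module.finrank K L = 3) (h : IsIndexFormBasis a b c d ω θ) (r x y : A) :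
    ⇑((basisOfTriple hL h.linearIndependent).repr
      (algebraMap A L r + algebraMap A L x * ω + algebraMap A L y * θ)) =
      ![algebraMap A K r, algebraMap A K x, algebraMap A K y] := by
  have : algebraMap A L r + algebraMap A L x * ω + algebraMap A L y * θ =
      ∑ j, ![algebraMap A K r, algebraMap A K x, algebraMap A K y] j •
        basisOfTriple hL h.linearIndependent j := by
    simp [Fin.sum_univ_three, Algebra.smul_def, ← IsScalarTower.algebraMap_apply A K L]
  rw [this, Module.Basis.repr_sum_self]

lemma trace_comb (hL : Module.finrank K L = 3) (h : IsIndexFormBasis a b c d ω θ) (r x y : A) :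
    Algebra.trace K L (algebraMap A L r + algebraMap A L x * ω + algebraMap A L y * θ) =
      algebraMap A K (3 * r + b * x - c * y) := by
  rw [Algebra.trace_eq_matrix_trace (basisOfTriple hL h.linearIndependent)]
  simp only [Matrix.trace, Matrix.diag_apply, Algebra.leftMulMatrix_eq_repr_mul,
    coe_basisOfTriple, Fin.sum_univ_three, Matrix.cons_val]
  have h0 := h.comb_mul_comb r x y 1 0 0
  have h1 := h.comb_mul_comb r x y 0 1 0
  have h2 := h.comb_mul_comb r x y 0 0 1
  simp only [map_one, map_zero, zero_mul, one_mul, zero_add, add_zero] at h0 h1 h2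
  rw [h0, h1, h2, h.repr_comb hL, h.repr_comb hL, h.repr_comb hL]
  simp only [Matrix.cons_val, ← map_add]
  congr 1
  ring

lemma discr_eq (hL : Module.finrank K L = 3) (h : IsIndexFormBasis a b c d ω θ) :
    Algebra.discr K ![1, ω, θ] = algebraMap A K (cubicFormDisc a b c d) := by
  have t : ∀ z r x y, z = algebraMap A L r + algebraMap A L x * ω + algebraMap A L y * θ →
      Algebra.trace K L z = algebraMap A K (3 * r + b * x - c * y) := by
    rintro _ r x y rfl
    exact h.trace_comb hL r x y
  have t00 := t 1 1 0 0 (by simp)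
  have t01 := t ω 0 1 0 (by simp)
  have t02 := t θ 0 0 1 (by simp)
  have t11 := t (ω * ω) (-(a * c)) b (-a) (by rw [h.fst_sq]; simp only [map_neg]; ring)
  have t12 := t (ω * θ) (-(a * d)) 0 0 (by rw [h.fst_mul_snd]; simp)
  have t22 := t (θ * θ) (-(b * d)) d (-c) (by rw [h.snd_sq]; simp only [map_neg]; ring)
  rw [Algebra.discr_def, Matrix.det_fin_three]
  simp only [Algebra.traceMatrix_apply, Algebra.traceForm_apply, Matrix.cons_val, one_mul, mul_one,
    mul_comm θ ω, t00, t01, t02, t11, t12, t22, ← map_mul, ← map_add, ← map_sub]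
  congr 1
  simp only [cubicFormDisc]
  ring

lemma exists_basis_integralClosure (h : IsIndexFormBasis a b c d ω θ) :
    ∃ w : Module.Basis (Fin 3) A (integralClosure A L), ∀ i, (w i : L) = ![1, ω, θ] i := by
  refine exists_basis_subalgebra h.linearIndependent (le_antisymm ?_ ?_)
  · rw [Submodule.span_le]
    rintro _ ⟨i, rfl⟩
    fin_cases i
    · exact isIntegral_one
    · exact h.isIntegral_fst
    · exact h.isIntegral_snd
  · intro z hz
    obtain ⟨r, x, y, rfl⟩ := h.exists_eq z hz
    rw [← mul_one (algebraMap A L r)]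
    simp only [← Algebra.smul_def]
    exact Submodule.add_mem _ (Submodule.add_mem _
      (Submodule.smul_mem _ _ (Submodule.subset_span ⟨0, rfl⟩))
      (Submodule.smul_mem _ _ (Submodule.subset_span ⟨1, rfl⟩)))
      (Submodule.smul_mem _ _ (Submodule.subset_span ⟨2, rfl⟩))

end IsIndexFormBasis

/-! ### Existence of a basis with a Delone–Faddeev table -/

section Existence

variable {A K L : Type*} [CommRing A] [Field K] [Algebra A K] [IsFractionRing A K]
  [CommRing L] [Algebra K L] [Algebra A L] [IsScalarTower A K L]

/-- Without a finite basis the trace is zero by convention, so a nonzero discriminant forces a basis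
to exist. An independent triple bounds its size below by 3, and the dimension of `L` bounds it
above. -/
lemma exists_basis_of_cubicDiscIdeal_ne_bot [IsDomain A] (hL : Module.finrank K L = 3)
    (hD : cubicDiscIdeal A (integralClosure A L) ≠ ⊥) :
    Nonempty (Module.Basis (Fin 3) A (integralClosure A L)) := by
  obtain ⟨v, hv⟩ : ∃ v : Fin 3 → integralClosure A L, Algebra.discr A v ≠ 0 := by
    by_contra! H
    exact hD (Ideal.span_eq_bot.2 (by rintro _ ⟨v, rfl⟩; exact H v))
  have hli : LinearIndependent A v := by
    by_contra H
    exact hv (Algebra.discr_zero_of_not_linearIndependent A H)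
  obtain ⟨s, ⟨w⟩⟩ : ∃ s : Finset (integralClosure A L),
      Nonempty (Module.Basis s A (integralClosure A L)) := by
    by_contra H
    apply hv
    rw [Algebra.discr_def, Matrix.det_eq_zero_of_row_eq_zero 0]
    intro j
    rw [Algebra.traceMatrix_apply, Algebra.traceForm_apply,
      Algebra.trace_eq_zero_of_not_exists_basis A H, LinearMap.zero_apply]
  have hw : LinearIndependent K (fun i => (w i : L)) :=
    (LinearIndependent.iff_fractionRing A K).1 (w.linearIndependent.map'
      (integralClosure A L).val.toLinearMap (LinearMap.ker_eq_bot.2 Subtype.val_injective))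
  have : FiniteDimensional K L := FiniteDimensional.of_finrank_pos (by omega)
  have h1 := hw.fintype_card_le_finrank
  have : Module.Finite A (integralClosure A L) := Module.Finite.of_basis w
  have h2 := hli.fintype_card_le_finrank
  rw [Module.finrank_eq_card_basis w] at h2
  rw [hL] at h1
  rw [Fintype.card_fin] at h2
  exact ⟨w.reindex (Fintype.equivFinOfCardEq (le_antisymm h1 h2))⟩

/-- The element `1` is primitive in the integral closure, so it extends to a basis. Translating the
other two vectors makes their product a scalar, and associativity then dictates the rest of the
table. -/
lemma exists_isIndexFormBasis [IsDomain A] [IsLocalRing A] [IsIntegrallyClosed A]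
    (hA : ¬ IsField A) [IsPrincipalIdealRing A] (hL : Module.finrank K L = 3)
    (hD : cubicDiscIdeal A (integralClosure A L) ≠ ⊥) :
    ∃ (a b c d : A) (ω θ : L), IsIndexFormBasis a b c d ω θ := by
  obtain ⟨v⟩ := exists_basis_of_cubicDiscIdeal_ne_bot hL hD
  have hnt : Nontrivial L := Module.nontrivial_of_finrank_pos (R := K) (by omega)
  -- Otherwise `p` divides `1` in the integral closure, so `p⁻¹` is integral over `A` and lies in
  -- `A`.
  obtain ⟨i, hi⟩ : ∃ i, IsUnit (v.repr 1 i) := by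
    by_contra! H
    obtain ⟨p, hp⟩ := IsPrincipalIdealRing.principal (IsLocalRing.maximalIdeal A)
    have hp0 : p ≠ 0 := by
      rintro rfl
      exact hA (IsLocalRing.isField_iff_maximalIdeal_eq.2 (by simpa using hp))
    have hdvd : ∀ i, ∃ t, v.repr 1 i = p * t := fun i => by
      have := (IsLocalRing.mem_maximalIdeal _).2 (H i)
      rw [hp] at this
      exact Ideal.mem_span_singleton.1 this
    choose t ht using hdvd
    have h1 : (1 : integralClosure A L) = p • ∑ i, t i • v i := by
      conv_lhs => rw [← v.sum_repr 1]
      simp only [ht, Finset.smul_sum, mul_smul]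
    set w := ∑ i, t i • v i
    have hw : algebraMap K L (algebraMap A K p)⁻¹ = w := by
      have h1' : (1 : L) = algebraMap A L p * w := by
        rw [Algebra.smul_def] at h1
        exact congrArg Subtype.val h1
      have : algebraMap A L p * algebraMap K L (algebraMap A K p)⁻¹ = 1 := by
        rw [IsScalarTower.algebraMap_apply A K L, ← map_mul, mul_inv_cancel₀ (by simpa), map_one]
      calc _ = algebraMap K L (algebraMap A K p)⁻¹ * (algebraMap A L p * w) := by
            rw [← h1', mul_one]
        _ = (algebraMap A L p * algebraMap K L (algebraMap A K p)⁻¹) * w := by ring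
        _ = w := by rw [this, one_mul]
    have hint : IsIntegral A (algebraMap A K p)⁻¹ := by
      rw [← isIntegral_algebraMap_iff (FaithfulSMul.algebraMap_injective K L), hw]
      exact w.2
    obtain ⟨y, hy⟩ := IsIntegrallyClosed.isIntegral_iff.1 hint
    have : p * y = 1 := by
      apply IsFractionRing.injective A K
      rw [map_mul, hy, mul_inv_cancel₀ (by simpa), map_one]
    have hpm : p ∈ IsLocalRing.maximalIdeal A := by rw [hp]; exact Ideal.mem_span_singleton_self p
    exact (IsLocalRing.mem_maximalIdeal _).1 hpm (IsUnit.of_mul_eq_one y this)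
  set w := v.reindex (Equiv.swap i 0) with hw
  obtain ⟨c0, hc0⟩ := hi
  have hsum : (1 : L) = algebraMap A L c0 * w 0 + algebraMap A L (w.repr 1 1) * w 1 +
      algebraMap A L (w.repr 1 2) * w 2 := by
    have := congrArg (Subtype.val) (w.sum_repr 1)
    simp only [Fin.sum_univ_three, Subalgebra.coe_add, Algebra.smul_def,
      OneMemClass.coe_one] at this
    rw [← this, hc0]
    simp [hw]
  have hspan : ∀ z : L, IsIntegral A z → ∃ r x y : A,
      z = algebraMap A L r * w 0 + algebraMap A L x * w 1 + algebraMap A L y * w 2 := by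
    intro z hz
    have := congrArg (Subtype.val) (w.sum_repr ⟨z, hz⟩)
    simp only [Fin.sum_univ_three, Subalgebra.coe_add, Algebra.smul_def]
      at this
    exact ⟨_, _, _, this.symm⟩
  have hindep : ∀ r x y : A,
      algebraMap A L r * w 0 + algebraMap A L x * w 1 + algebraMap A L y * w 2 = 0 →
      r = 0 ∧ x = 0 ∧ y = 0 := by
    intro r x y hz
    have h3 := Fintype.linearIndependent_iff.1 (linearIndependent_coe_basis w) ![r, x, y]
      (by simpa [Fin.sum_univ_three, Algebra.smul_def] using hz)
    exact ⟨h3 0, h3 1, h3 2⟩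
  have hint : ∀ i, IsIntegral A (w i : L) := fun i => (w i).2
  generalize (w 0 : L) = w0 at *
  generalize h1 : (w 1 : L) = e1 at *
  generalize h2 : (w 2 : L) = e2 at *
  generalize w.repr 1 1 = c1 at *
  generalize w.repr 1 2 = c2 at *
  have hu : algebraMap A L (↑c0⁻¹ : A) * algebraMap A L c0 = 1 := by
    rw [← map_mul, Units.inv_mul, map_one]
  have hu' : (↑c0⁻¹ : A) * c0 = 1 := c0.inv_mul
  -- `1, e1, e2` is a basis
  have hspan' : ∀ z : L, IsIntegral A z → ∃ r x y : A,
      z = algebraMap A L r + algebraMap A L x * e1 + algebraMap A L y * e2 := by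
    intro z hz
    obtain ⟨r, x, y, rfl⟩ := hspan z hz
    refine ⟨r * ↑c0⁻¹, x - r * ↑c0⁻¹ * c1, y - r * ↑c0⁻¹ * c2, ?_⟩
    simp only [map_mul, map_sub]
    linear_combination (-algebraMap A L r * w0) * hu
      - algebraMap A L r * algebraMap A L (↑c0⁻¹ : A) * hsum
  have hindep' : ∀ r x y : A,
      algebraMap A L r + algebraMap A L x * e1 + algebraMap A L y * e2 = 0 →
      r = 0 ∧ x = 0 ∧ y = 0 := by
    intro r x y hz
    obtain ⟨g0, g1, g2⟩ := hindep (r * c0) (x + r * c1) (y + r * c2) (by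
      simp only [map_mul, map_add]
      linear_combination hz - algebraMap A L r * hsum)
    have hr : r = 0 := by simpa using g0
    subst hr
    exact ⟨rfl, by simpa using g1, by simpa using g2⟩
  have hi1 : IsIntegral A e1 := h1 ▸ hint 1
  have hi2 : IsIntegral A e2 := h2 ▸ hint 2
  -- From `e1 e2 = r + s e1 + t e2` one gets `(e1 - t)(e2 - s) = r + s t`.
  obtain ⟨r, s, t, hrst⟩ := hspan' _ (hi1.mul hi2)
  set ω := e1 - algebraMap A L t with hω
  set θ := e2 - algebraMap A L s with hθ
  have hspan'' : ∀ z : L, IsIntegral A z → ∃ r x y : A,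
      z = algebraMap A L r + algebraMap A L x * ω + algebraMap A L y * θ := by
    intro z hz
    obtain ⟨r, x, y, rfl⟩ := hspan' z hz
    refine ⟨r + x * t + y * s, x, y, ?_⟩
    simp only [map_mul, map_add, hω, hθ]
    ring
  have hindep'' : ∀ r x y : A,
      algebraMap A L r + algebraMap A L x * ω + algebraMap A L y * θ = 0 →
      r = 0 ∧ x = 0 ∧ y = 0 := by
    intro r x y hz
    obtain ⟨g0, g1, g2⟩ := hindep' (r - x * t - y * s) x y (by
      simp only [map_mul, map_sub]
      linear_combination hz)
    subst g1 g2
    exact ⟨by simpa using g0, rfl, rfl⟩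
  have hp : ω * θ = algebraMap A L (r + s * t) := by
    simp only [map_mul, map_add, hω, hθ]
    linear_combination hrst
  have hiω : IsIntegral A ω := hi1.sub isIntegral_algebraMap
  have hiθ : IsIntegral A θ := hi2.sub isIntegral_algebraMap
  generalize r + s * t = p at hp
  clear_value ω θ
  obtain ⟨m, b, a, hm⟩ := hspan'' _ (hiω.mul hiω)
  obtain ⟨l, d, c, hl⟩ := hspan'' _ (hiθ.mul hiθ)
  -- Comparing coordinates in `ω (ω θ) = (ω ω) θ`, and next in `θ (ω θ) = ω (θ θ)`, determines the
  -- constant terms `m`, `p` and `l`.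
  obtain ⟨g0, g1, g2⟩ := hindep'' (b * p + a * l) (a * d - p) (m + a * c) (by
    simp only [map_mul, map_add, map_sub]
    linear_combination ω * hp - θ * hm - algebraMap A L a * hl - algebraMap A L b * hp)
  obtain ⟨k0, k1, k2⟩ := hindep'' (d * m + c * p) (l + d * b) (d * a - p) (by
    simp only [map_mul, map_add, map_sub]
    linear_combination θ * hp - ω * hl - algebraMap A L d * hm - algebraMap A L c * hp)
  refine ⟨-a, b, -c, d, ω, θ, ?_, ?_, ?_, hindep'', hspan''⟩
  · rw [hm, show m = -(-a * -c) by linear_combination g2]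
    simp only [map_mul, map_neg]; ring
  · rw [hp, show p = -(-a * d) by linear_combination -g1]
  · rw [hl, show l = -(b * d) by linear_combination k1]
    simp only [map_mul, map_neg]; ring

end Existence

/-! ### Hermite normal forms and the ring condition -/

section Lattice

variable {A L : Type*} [CommRing A] [CommRing L] [Algebra A L] {a b c d : A} {ω θ : L}

/-- The lattice spanned by `1`, `p ^ j ω` and `u ω + p ^ i θ`. -/
def hermiteLattice (ω θ : L) (p : A) (i j : ℕ) (u : A) : Submodule A L :=
  Submodule.span A (Set.range
    ![1, algebraMap A L (p ^ j) * ω, algebraMap A L u * ω + algebraMap A L (p ^ i) * θ])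

/-- The conditions on `i`, `j`, `u` for the lattice spanned by `1`, `p ^ j ω` and `u ω + p ^ i θ`
to be a ring, where `ω`, `θ` have index form `(a, b, c, d)`. -/
structure IsHermiteOrder (a b c d p : A) (i j : ℕ) (u : A) : Prop where
  fst_dvd : p ^ i ∣ a * p ^ (2 * j)
  snd_dvd : p ^ i ∣ a * u ^ 2
  form_dvd : p ^ (i + j) ∣ a * u ^ 3 + b * u ^ 2 * p ^ i + c * u * p ^ (2 * i) + d * p ^ (3 * i)

/-- The conditions for the lattice spanned by `1`, `p ^ j ω` and `u ω + p ^ i θ` to have traces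
divisible by `p ^ t`, if `p ^ t ∣ 3`. -/
structure IsHermiteTraced (b c p : A) (t i j : ℕ) (u : A) : Prop where
  fst_dvd : p ^ t ∣ b * p ^ j
  snd_dvd : p ^ t ∣ b * u - c * p ^ i

lemma mem_hermiteLattice {p : A} {i j : ℕ} {u : A} {z : L} :
    z ∈ hermiteLattice ω θ p i j u ↔ ∃ r s t : A, z = algebraMap A L r +
      algebraMap A L (s * p ^ j + t * u) * ω + algebraMap A L (t * p ^ i) * θ := by
  rw [hermiteLattice, Submodule.mem_span_range_iff_exists_fun]
  constructor
  · rintro ⟨g, rfl⟩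
    refine ⟨g 0, g 1, g 2, ?_⟩
    simp only [Fin.sum_univ_three, Matrix.cons_val, Algebra.smul_def, map_add, map_mul]
    ring
  · rintro ⟨r, s, t, rfl⟩
    refine ⟨![r, s, t], ?_⟩
    simp only [Fin.sum_univ_three, Matrix.cons_val, Algebra.smul_def, map_add, map_mul]
    ring

namespace IsIndexFormBasis

lemma comb_mem_hermiteLattice (h : IsIndexFormBasis a b c d ω θ) {p : A} {i j : ℕ} {u r x y : A} :
    algebraMap A L r + algebraMap A L x * ω + algebraMap A L y * θ ∈ hermiteLattice ω θ p i j u ↔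
      ∃ s t : A, x = s * p ^ j + t * u ∧ y = t * p ^ i := by
  rw [mem_hermiteLattice]
  constructor
  · rintro ⟨r', s, t, e⟩
    obtain ⟨-, h2, h3⟩ := h.comb_injective e
    exact ⟨s, t, h2, h3⟩
  · rintro ⟨s, t, rfl, rfl⟩
    exact ⟨r, s, t, rfl⟩

/-- The multiples of `ω` in the lattice recover `j`, and the sum `i + j` then recovers `i`. Two
vectors with the same `θ`-coordinate `p^i` differ by such a multiple, which leaves `u` free modulo
`p^j`. -/
lemma hermiteLattice_eq_iff [IsDomain A] (h : IsIndexFormBasis a b c d ω θ) {p : A}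
    (hp : Prime p) {i j i' j' : ℕ} (hij : i + j = i' + j') {u u' : A} :
    hermiteLattice ω θ p i j u = hermiteLattice ω θ p i' j' u' ↔ j = j' ∧ p ^ j ∣ u - u' := by
  constructor
  · intro e
    have key : ∀ {i j i' j' : ℕ} {u u' : A},
        hermiteLattice ω θ p i j u ≤ hermiteLattice ω θ p i' j' u' → j' ≤ j := by
      intro i j i' j' u u' e
      have : algebraMap A L 0 + algebraMap A L (p ^ j) * ω + algebraMap A L 0 * θ ∈
          hermiteLattice ω θ p i' j' u' :=
        e (h.comb_mem_hermiteLattice.2 ⟨1, 0, by ring, by ring⟩)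
      obtain ⟨s, t, h1, h2⟩ := h.comb_mem_hermiteLattice.1 this
      have ht : t = 0 := by
        rcases mul_eq_zero.1 h2.symm with h | h
        · exact h
        · exact absurd h (pow_ne_zero _ hp.ne_zero)
      subst ht
      exact (pow_dvd_pow_iff hp.ne_zero hp.not_isUnit).1 ⟨s, by rw [h1]; ring⟩
    obtain rfl : j = j' := le_antisymm (key e.ge) (key e.le)
    obtain rfl : i = i' := by omega
    refine ⟨rfl, ?_⟩
    have : algebraMap A L 0 + algebraMap A L u * ω + algebraMap A L (p ^ i) * θ ∈
        hermiteLattice ω θ p i j u' :=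
      e.le (h.comb_mem_hermiteLattice.2 ⟨0, 1, by ring, by ring⟩)
    obtain ⟨s, t, h1, h2⟩ := h.comb_mem_hermiteLattice.1 this
    have ht : t = 1 := mul_right_cancel₀ (pow_ne_zero i hp.ne_zero) (by rw [one_mul, ← h2])
    subst ht
    exact ⟨s, by rw [h1]; ring⟩
  · rintro ⟨rfl, v, hv⟩
    obtain rfl : i = i' := by omega
    ext z
    simp only [mem_hermiteLattice]
    constructor
    · rintro ⟨r, s, t, rfl⟩
      refine ⟨r, s + t * v, t, ?_⟩
      rw [show u = u' + p ^ j * v by linear_combination hv]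
      congr 4
      ring
    · rintro ⟨r, s, t, rfl⟩
      refine ⟨r, s - t * v, t, ?_⟩
      rw [show u = u' + p ^ j * v by linear_combination hv]
      congr 4
      ring

/-- The squares of the two nontrivial generators already give all three conditions; closure under
the mixed product is then automatic. -/
lemma mul_mem_hermiteLattice_iff [IsDomain A] [IsIntegrallyClosed A]
    (h : IsIndexFormBasis a b c d ω θ) {p : A} (hp : Prime p) {i j : ℕ} {u : A} :
    (∀ z w, z ∈ hermiteLattice ω θ p i j u → w ∈ hermiteLattice ω θ p i j u →
      z * w ∈ hermiteLattice ω θ p i j u) ↔ IsHermiteOrder a b c d p i j u := by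
  constructor
  · intro H
    have e1 : algebraMap A L 0 + algebraMap A L (p ^ j) * ω + algebraMap A L 0 * θ ∈
        hermiteLattice ω θ p i j u := h.comb_mem_hermiteLattice.2 ⟨1, 0, by ring, by ring⟩
    have e2 : algebraMap A L 0 + algebraMap A L u * ω + algebraMap A L (p ^ i) * θ ∈
        hermiteLattice ω θ p i j u := h.comb_mem_hermiteLattice.2 ⟨0, 1, by ring, by ring⟩
    have m1 := H _ _ e1 e1
    have m2 := H _ _ e2 e2
    rw [h.comb_mul_comb, h.comb_mem_hermiteLattice] at m1 m2
    obtain ⟨s1, t1, -, h1⟩ := m1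
    obtain ⟨s2, t2, h2, h3⟩ := m2
    refine ⟨⟨-t1, by linear_combination -h1⟩, ⟨-t2 - c * p ^ i, by linear_combination -h3⟩,
      ⟨s2, ?_⟩⟩
    -- Eliminating `t2` between the two coordinates of the square leaves `f(u, p^i) = s2 p^(i+j)`.
    linear_combination p ^ i * h2 - u * h3
  · rintro ⟨⟨α1, h1⟩, ⟨α2, h2⟩, ⟨α3, h3⟩⟩ z w hz hw
    have hpi : p ^ i ≠ 0 := pow_ne_zero _ hp.ne_zero
    -- The mixed product requires this. The square of the right side is `(a p^(2j)) (a u²)`,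
    -- divisible by `p^(2i)`, and divisibility of squares descends in an integrally closed domain.
    obtain ⟨α4, h4⟩ : p ^ i ∣ a * u * p ^ j := by
      rw [← IsIntegrallyClosed.pow_dvd_pow_iff two_ne_zero]
      exact ⟨α1 * α2, by linear_combination a * u ^ 2 * h1 + p ^ i * α1 * h2⟩
    have h5 : α1 * u = p ^ j * α4 :=
      mul_left_cancel₀ hpi (by linear_combination p ^ j * h4 - u * h1)
    have h6 : α4 * u = p ^ j * α2 :=
      mul_left_cancel₀ hpi (by linear_combination p ^ j * h2 - u * h4)
    have h7 : b * u ^ 2 + d * p ^ (2 * i) = α3 * p ^ j - (α2 + c * p ^ i) * u :=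
      mul_left_cancel₀ hpi (by linear_combination h3 - u * h2)
    obtain ⟨r, s, t, rfl⟩ := mem_hermiteLattice.1 hz
    obtain ⟨r', s', t', rfl⟩ := mem_hermiteLattice.1 hw
    rw [h.comb_mul_comb, h.comb_mem_hermiteLattice]
    refine ⟨r * s' + s * r' + s * s' * (b * p ^ j + α4) + (s * t' + t * s') * (b * u + α2) +
      t * t' * α3, r * t' + t * r' - s * s' * α1 - (s * t' + t * s') * α4 -
      t * t' * (α2 + c * p ^ i), ?_, ?_⟩
    · linear_combination s * s' * h5 + (s * t' + t * s') * h6 + t * t' * h7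
    · linear_combination -s * s' * h1 - (s * t' + t * s') * h4 - t * t' * h2

lemma linearIndependent_hermite [IsDomain A] (h : IsIndexFormBasis a b c d ω θ) {p : A}
    (hp : Prime p) (i j : ℕ) (u : A) : LinearIndependent A
      ![1, algebraMap A L (p ^ j) * ω, algebraMap A L u * ω + algebraMap A L (p ^ i) * θ] := by
  rw [Fintype.linearIndependent_iff]
  intro g hg
  simp only [Fin.sum_univ_three, Matrix.cons_val, Algebra.smul_def, mul_one] at hg
  obtain ⟨h1, h2, h3⟩ := h.indep (g 0) (g 1 * p ^ j + g 2 * u) (g 2 * p ^ i) (by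
    simp only [map_mul, map_add] at hg ⊢
    linear_combination hg)
  have h4 : g 2 = 0 := by
    rcases mul_eq_zero.1 h3 with h | h
    · exact h
    · exact absurd h (pow_ne_zero _ hp.ne_zero)
  have h5 : g 1 = 0 := by
    rw [h4, zero_mul, add_zero] at h2
    rcases mul_eq_zero.1 h2 with h | h
    · exact h
    · exact absurd h (pow_ne_zero _ hp.ne_zero)
  intro k
  fin_cases k <;> assumption

end IsIndexFormBasis

end Lattice

/-! ### Orders as Hermite lattices; their discriminants and traces -/

section Orders

variable {A K L : Type*} [CommRing A] [Field K] [Algebra A K] [IsFractionRing A K]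
  [CommRing L] [Algebra K L] [Algebra A L] [IsScalarTower A K L] {a b c d : A} {ω θ : L}

lemma exists_smul_mem_of_isLattice [IsDomain A] {M : Submodule A L} (hM : M.IsLattice K) (z : L) :
    ∃ s : A, s ≠ 0 ∧ algebraMap A L s * z ∈ M := by
  have hz : z ∈ Submodule.span K (M : Set L) := by rw [hM.span_eq_top]; trivial
  induction hz using Submodule.span_induction with
  | mem x hx => exact ⟨1, one_ne_zero, by simpa using hx⟩
  | zero => exact ⟨1, one_ne_zero, by simp⟩
  | add x y _ _ hx hy =>
    obtain ⟨s, hs, hsx⟩ := hx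
    obtain ⟨t, ht, hty⟩ := hy
    refine ⟨s * t, mul_ne_zero hs ht, ?_⟩
    have := M.add_mem (M.smul_mem t hsx) (M.smul_mem s hty)
    simp only [Algebra.smul_def] at this
    convert this using 1
    rw [map_mul]; ring
  | smul k x _ hx =>
    obtain ⟨s, hs, hsx⟩ := hx
    obtain ⟨r, t, ht, rfl⟩ := IsFractionRing.div_surjective (A := A) k
    have ht0 : t ≠ 0 := nonZeroDivisors.ne_zero ht
    refine ⟨s * t, mul_ne_zero hs ht0, ?_⟩
    have := M.smul_mem r hsx
    simp only [Algebra.smul_def] at this ⊢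
    convert this using 1
    have : algebraMap A L t * algebraMap K L (algebraMap A K r / algebraMap A K t) =
        algebraMap A L r := by
      rw [IsScalarTower.algebraMap_apply A K L, ← map_mul, mul_div_cancel₀ _ (by simpa),
        ← IsScalarTower.algebraMap_apply]
    rw [map_mul]
    linear_combination algebraMap A L s * x * this

namespace IsIndexFormBasis

/-- Hermite reduction: `I` collects the multiples of `ω` in the order, `J` the `θ`-coordinates of
its elements. Both are nonzero since the order spans `L`, hence they are generated by powers `p^j`
and `p^i`. Elements of the order are integral, so they have coordinates in `A`. -/
lemma exists_eq_hermiteLattice [IsDomain A] [IsDiscreteValuationRing A]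
    (h : IsIndexFormBasis a b c d ω θ) {p : A} (hp : Irreducible p) {O : Subalgebra A L}
    (hO : (Subalgebra.toSubmodule O).IsLattice K) :
    ∃ i j u, Subalgebra.toSubmodule O = hermiteLattice ω θ p i j u := by
  let I : Ideal A :=
    { carrier := {x | algebraMap A L x * ω ∈ O}
      zero_mem' := by simp
      add_mem' := fun {x y} hx hy => by
        have := O.add_mem hx hy
        simpa [add_mul] using this
      smul_mem' := fun r x hx => by
        have := O.mul_mem (O.algebraMap_mem r) hx
        simpa [mul_assoc] using this }
  let J : Ideal A :=
    { carrier := {y | ∃ x, algebraMap A L x * ω + algebraMap A L y * θ ∈ O}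
      zero_mem' := ⟨0, by simp⟩
      add_mem' := by
        rintro y y' ⟨x, hx⟩ ⟨x', hx'⟩
        refine ⟨x + x', ?_⟩
        have := O.add_mem hx hx'
        convert this using 1
        simp only [map_add]; ring
      smul_mem' := by
        rintro r y ⟨x, hx⟩
        refine ⟨r * x, ?_⟩
        have := O.mul_mem (O.algebraMap_mem r) hx
        convert this using 1
        simp only [map_mul, smul_eq_mul]; ring }
  have hI : I ≠ ⊥ := by
    obtain ⟨s, hs, hsx⟩ := exists_smul_mem_of_isLattice hO ω
    exact fun e => hs ((Submodule.eq_bot_iff _).1 e s hsx)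
  have hJ : J ≠ ⊥ := by
    obtain ⟨s, hs, hsx⟩ := exists_smul_mem_of_isLattice hO θ
    exact fun e => hs ((Submodule.eq_bot_iff _).1 e s ⟨0, by simpa using hsx⟩)
  obtain ⟨j, hj⟩ := IsDiscreteValuationRing.ideal_eq_span_pow_irreducible hI hp
  obtain ⟨i, hi⟩ := IsDiscreteValuationRing.ideal_eq_span_pow_irreducible hJ hp
  have hIj : algebraMap A L (p ^ j) * ω ∈ O := by
    have : p ^ j ∈ I := hj ▸ Ideal.mem_span_singleton_self _
    exact this
  obtain ⟨u, hu⟩ : ∃ u, algebraMap A L u * ω + algebraMap A L (p ^ i) * θ ∈ O := by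
    have : p ^ i ∈ J := hi ▸ Ideal.mem_span_singleton_self _
    exact this
  refine ⟨i, j, u, le_antisymm ?_ ?_⟩
  · intro z hz
    have hz' : z ∈ O := hz
    obtain ⟨r, x, y, rfl⟩ := h.exists_eq z (IsIntegral.of_mem_of_fg O hO.fg z hz)
    have hxy : algebraMap A L x * ω + algebraMap A L y * θ ∈ O := by
      have := O.sub_mem hz' (O.algebraMap_mem r)
      convert this using 1; ring
    have hy : y ∈ J := ⟨x, hxy⟩
    rw [hi, Ideal.mem_span_singleton] at hy
    obtain ⟨t, rfl⟩ := hy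
    have hx : x - t * u ∈ I := by
      have := O.sub_mem hxy (O.mul_mem (O.algebraMap_mem t) hu)
      change algebraMap A L (x - t * u) * ω ∈ O
      convert this using 1
      simp only [map_sub, map_mul]; ring
    rw [hj, Ideal.mem_span_singleton] at hx
    obtain ⟨s, hs⟩ := hx
    exact h.comb_mem_hermiteLattice.2 ⟨s, t, by linear_combination hs, by ring⟩
  · refine Submodule.span_le.2 ?_
    rintro _ ⟨k, rfl⟩
    fin_cases k
    · exact O.one_mem
    · exact hIj
    · exact hu

lemma exists_basis_hermite [IsDomain A] (h : IsIndexFormBasis a b c d ω θ) {p : A} (hp : Prime p)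
    {i j : ℕ} {u : A} {O : Subalgebra A L}
    (hO : Subalgebra.toSubmodule O = hermiteLattice ω θ p i j u) :
    ∃ w : Module.Basis (Fin 3) A O, ∀ k, (w k : L) =
      ![1, algebraMap A L (p ^ j) * ω, algebraMap A L u * ω + algebraMap A L (p ^ i) * θ] k :=
  exists_basis_subalgebra (h.linearIndependent_hermite hp i j u) hO.symm

lemma isLattice_hermiteLattice [IsDomain A] (hL : Module.finrank K L = 3)
    (h : IsIndexFormBasis a b c d ω θ) {p : A} (hp : Prime p) (i j : ℕ) (u : A) :
    (hermiteLattice ω θ p i j u).IsLattice K where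
  fg := Submodule.fg_span (Set.finite_range _)
  span_eq_top := by
    refine top_unique ?_
    rw [← (basisOfTriple (K := K) hL (h.linearIndependent_hermite hp i j u)).span_eq,
      coe_basisOfTriple]
    exact Submodule.span_mono Submodule.subset_span

lemma cubicDiscIdeal_eq [IsDomain A] (hL : Module.finrank K L = 3)
    (h : IsIndexFormBasis a b c d ω θ) {p : A} (hp : Prime p)
    {i j : ℕ} {u : A} {O : Subalgebra A L}
    (hO : Subalgebra.toSubmodule O = hermiteLattice ω θ p i j u) :
    cubicDiscIdeal A O = Ideal.span {cubicFormDisc a b c d} * Ideal.span {p} ^ (2 * (i + j)) := by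
  obtain ⟨w, hw⟩ := h.exists_basis_hermite hp hO
  rw [cubicDiscIdeal_eq_span w, Ideal.span_singleton_pow, Ideal.span_singleton_mul_span_singleton]
  congr 2
  apply IsFractionRing.injective A K
  rw [algebraMap_discr_subalgebra hL w]
  -- The change of basis has determinant `p^(i+j)`, whose square multiplies the discriminant.
  have : (fun k => (w k : L)) = (Matrix.map !![1, 0, 0; 0, algebraMap A K (p ^ j), 0;
      0, algebraMap A K u, algebraMap A K (p ^ i)] (algebraMap K L)).mulVec ![1, ω, θ] := by
    funext k
    rw [hw]
    fin_cases k <;> simp [Matrix.mulVec, dotProduct, Fin.sum_univ_three,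
      ← IsScalarTower.algebraMap_apply A K L]
  rw [this, Algebra.discr_of_matrix_mulVec, h.discr_eq hL, Matrix.det_fin_three]
  simp
  ring

lemma cubicDiscIdeal_integralClosure [IsDomain A] (hL : Module.finrank K L = 3)
    (h : IsIndexFormBasis a b c d ω θ) :
    cubicDiscIdeal A (integralClosure A L) = Ideal.span {cubicFormDisc a b c d} := by
  obtain ⟨w, hw⟩ := h.exists_basis_integralClosure
  rw [cubicDiscIdeal_eq_span w]
  congr 2
  apply IsFractionRing.injective A K
  rw [algebraMap_discr_subalgebra hL w, ← h.discr_eq hL]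
  congr 1
  exact funext hw

/-- The trace of `r + x ω + y θ` is `3 r + b x - c y`; as `p^t ∣ 3`, only the generators other than
`1` impose a condition. -/
lemma traceIdeal_le_iff [IsDomain A] (hL : Module.finrank K L = 3)
    (h : IsIndexFormBasis a b c d ω θ) {p : A} (hp : Prime p) {t : ℕ} (h3 : p ^ t ∣ 3)
    {i j : ℕ} {u : A} {O : Subalgebra A L}
    (hO : Subalgebra.toSubmodule O = hermiteLattice ω θ p i j u) :
    traceIdeal A O ≤ Ideal.span {p} ^ t ↔ IsHermiteTraced b c p t i j u := by
  obtain ⟨w, hw⟩ := h.exists_basis_hermite hp hO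
  have key : ∀ (z : O) (r x y : A),
      (z : L) = algebraMap A L r + algebraMap A L x * ω + algebraMap A L y * θ →
      Algebra.trace A O z = 3 * r + b * x - c * y := by
    intro z r x y hz
    apply IsFractionRing.injective A K
    rw [algebraMap_trace_subalgebra hL w, hz, h.trace_comb hL]
  rw [Ideal.span_singleton_pow]
  constructor
  · intro H
    have H' : ∀ z : O, p ^ t ∣ Algebra.trace A O z := fun z =>
      Ideal.mem_span_singleton.1 (H ⟨z, rfl⟩)
    have h1 := H' (w 1)
    have h2 := H' (w 2)
    rw [key (w 1) 0 (p ^ j) 0 (by rw [hw]; simp)] at h1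
    rw [key (w 2) 0 u (p ^ i) (by rw [hw]; simp)] at h2
    exact ⟨by simpa using h1, by simpa using h2⟩
  · rintro ⟨h1, h2⟩ _ ⟨z, rfl⟩
    obtain ⟨r, x, y, hz⟩ := mem_hermiteLattice.1 (hO ▸ z.2 : (z : L) ∈ hermiteLattice ω θ p i j u)
    rw [key z _ _ _ hz, Ideal.mem_span_singleton]
    have := ((h3.mul_right r).add (h1.mul_left x)).add (h2.mul_left y)
    convert this using 1
    ring

lemma mem_tracedOrders_iff [IsDomain A] [IsDiscreteValuationRing A] (hL : Module.finrank K L = 3)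
    (h : IsIndexFormBasis a b c d ω θ) {p : A} (hp : Irreducible p) {t d₀ n : ℕ} (h3 : p ^ t ∣ 3)
    (hD : Ideal.span {cubicFormDisc a b c d} = IsLocalRing.maximalIdeal A ^ d₀)
    (O : Subalgebra A L) :
    O ∈ tracedOrders A K L (IsLocalRing.maximalIdeal A ^ (d₀ + 2 * n))
        (IsLocalRing.maximalIdeal A ^ t) ↔
      ∃ i j u, i + j = n ∧ IsHermiteOrder a b c d p i j u ∧ IsHermiteTraced b c p t i j u ∧
        Subalgebra.toSubmodule O = hermiteLattice ω θ p i j u := by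
  have hm : IsLocalRing.maximalIdeal A = Ideal.span {p} := hp.maximalIdeal_eq
  have hdisc : ∀ {i j u}, Subalgebra.toSubmodule O = hermiteLattice ω θ p i j u →
      cubicDiscIdeal A O = IsLocalRing.maximalIdeal A ^ (d₀ + 2 * (i + j)) := fun hO => by
    rw [h.cubicDiscIdeal_eq hL hp.prime hO, hD, hm, ← pow_add]
  constructor
  · rintro ⟨h1, h2, h3'⟩
    obtain ⟨i, j, u, hO⟩ := h.exists_eq_hermiteLattice hp h1
    refine ⟨i, j, u, ?_, ?_, ?_, hO⟩
    · have hdvd : ∀ m n : ℕ, IsLocalRing.maximalIdeal A ^ m ≤ IsLocalRing.maximalIdeal A ^ n →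
          n ≤ m := by
        intro m n hmn
        rw [hm, Ideal.span_singleton_pow, Ideal.span_singleton_pow,
          Ideal.span_singleton_le_span_singleton] at hmn
        exact (pow_dvd_pow_iff hp.ne_zero hp.not_isUnit).1 hmn
      have e := (hdisc hO).symm.trans h2
      have e1 := hdvd _ _ e.le
      have e2 := hdvd _ _ e.ge
      omega
    · rw [← h.mul_mem_hermiteLattice_iff hp.prime, ← hO]
      exact fun z w hz hw => O.mul_mem hz hw
    · rwa [← h.traceIdeal_le_iff hL hp.prime h3 hO, ← hm]
  · rintro ⟨i, j, u, rfl, -, h2, hO⟩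
    refine ⟨?_, hdisc hO, ?_⟩
    · rw [hO]
      exact h.isLattice_hermiteLattice hL hp.prime i j u
    · rwa [hm, h.traceIdeal_le_iff hL hp.prime h3 hO]

lemma exists_subalgebra_eq_hermiteLattice [IsDomain A] [IsIntegrallyClosed A]
    (h : IsIndexFormBasis a b c d ω θ) {p : A} (hp : Prime p) {i j : ℕ} {u : A}
    (hu : IsHermiteOrder a b c d p i j u) :
    ∃ O : Subalgebra A L, Subalgebra.toSubmodule O = hermiteLattice ω θ p i j u :=
  ⟨(hermiteLattice ω θ p i j u).toSubalgebra (Submodule.subset_span ⟨0, rfl⟩)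
    fun z w hz hw => (h.mul_mem_hermiteLattice_iff hp).2 hu z w hz hw,
    Submodule.toSubalgebra_toSubmodule _ _ _⟩

end IsIndexFormBasis

end Orders

/-! ### Counting residue classes -/

section ResidueCount

variable {A : Type*} [CommRing A]

/-- The number of residue classes modulo `p ^ j` that meet `U`. -/
noncomputable def residueCount (p : A) (j : ℕ) (U : Set A) : ℕ :=
  (Ideal.Quotient.mk (Ideal.span {p ^ j}) '' U).ncard

lemma residueCount_empty (p : A) (j : ℕ) : residueCount p j ∅ = 0 := by
  simp [residueCount]

lemma mk_span_pow_eq_iff {p : A} {j : ℕ} {u v : A} :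
    Ideal.Quotient.mk (Ideal.span {p ^ j}) u = Ideal.Quotient.mk (Ideal.span {p ^ j}) v ↔
      p ^ j ∣ u - v := by
  rw [Ideal.Quotient.eq, Ideal.mem_span_singleton]

variable [IsDomain A] [IsDiscreteValuationRing A]

lemma card_quotient_span_pow {p : A} (hp : Irreducible p) (j : ℕ) :
    Nat.card (A ⧸ Ideal.span {p ^ j}) = Nat.card (IsLocalRing.ResidueField A) ^ j := by
  have hm : IsLocalRing.maximalIdeal A = Ideal.span {p} := hp.maximalIdeal_eq
  have := cardQuot_pow_of_prime (S := A) (P := IsLocalRing.maximalIdeal A)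
    (IsDiscreteValuationRing.not_a_field A) (i := j)
  rw [Submodule.cardQuot_apply, Submodule.cardQuot_apply, hm, Ideal.span_singleton_pow, ← hm] at this
  exact this

lemma finite_quotient_span_pow [Finite (IsLocalRing.ResidueField A)] {p : A} (hp : Irreducible p)
    (j : ℕ) : Finite (A ⧸ Ideal.span {p ^ j}) := by
  refine Nat.finite_of_card_ne_zero ?_
  rw [card_quotient_span_pow hp]
  exact pow_ne_zero _ Nat.card_pos.ne'

/-- The number of classes modulo `p ^ j` in a disjoint union of classes modulo `p ^ k`. -/
lemma residueCount_iUnion {p : A} (hp : Irreducible p) {j k : ℕ} (hkj : k ≤ j) {ι : Type*}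
    {x : ι → A} (hx : ∀ z w, p ^ k ∣ x z - x w → z = w) :
    residueCount p j {u | ∃ z, p ^ k ∣ u - x z} =
      Nat.card ι * Nat.card (IsLocalRing.ResidueField A) ^ (j - k) := by
  obtain ⟨l, rfl⟩ := Nat.exists_eq_add_of_le hkj
  rw [Nat.add_sub_cancel_left, ← card_quotient_span_pow hp, ← Nat.card_prod]
  -- Multiplication by `p^k` embeds `A / p^l` in `A / p^(k+l)`; its translates by the `x z`
  -- parametrize the classes to be counted.
  have hle : Ideal.span {p ^ l} ≤ Submodule.comap (LinearMap.mulLeft A (p ^ k))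
      (Ideal.span {p ^ (k + l)}) := by
    intro w hw
    rw [Ideal.mem_span_singleton] at hw
    change p ^ k * w ∈ Ideal.span {p ^ (k + l)}
    rw [Ideal.mem_span_singleton, pow_add]
    exact mul_dvd_mul_left _ hw
  let f : ι × (A ⧸ Ideal.span {p ^ l}) → A ⧸ Ideal.span {p ^ (k + l)} := fun zw =>
    Ideal.Quotient.mk _ (x zw.1) +
      Submodule.mapQ (Ideal.span {p ^ l}) (Ideal.span {p ^ (k + l)})
        (LinearMap.mulLeft A (p ^ k)) hle zw.2
  have hf : ∀ z w, f (z, Ideal.Quotient.mk _ w) = Ideal.Quotient.mk _ (x z + p ^ k * w) := by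
    intro z w
    rw [map_add]
    rfl
  have hinj : Function.Injective f := by
    rintro ⟨z, w⟩ ⟨z', w'⟩ e
    obtain ⟨w, rfl⟩ := Ideal.Quotient.mk_surjective w
    obtain ⟨w', rfl⟩ := Ideal.Quotient.mk_surjective w'
    rw [hf, hf, mk_span_pow_eq_iff] at e
    obtain ⟨v, hv⟩ := e
    obtain rfl : z = z' := hx _ _ ⟨p ^ l * v - w + w', by linear_combination hv⟩
    congr 1
    rw [mk_span_pow_eq_iff]
    exact ⟨v, mul_left_cancel₀ (pow_ne_zero k hp.ne_zero) (by linear_combination hv)⟩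
  rw [← Nat.card_range_of_injective hinj, residueCount, Nat.card_coe_set_eq]
  congr 1
  ext y
  constructor
  · rintro ⟨u, ⟨z, w, hw⟩, rfl⟩
    refine ⟨(z, Ideal.Quotient.mk _ w), ?_⟩
    rw [hf]
    congr 1
    linear_combination -hw
  · rintro ⟨⟨z, w⟩, rfl⟩
    obtain ⟨w, rfl⟩ := Ideal.Quotient.mk_surjective w
    exact ⟨x z + p ^ k * w, ⟨z, w, by ring⟩, (hf z w).symm⟩

lemma residueCount_dvd {p : A} (hp : Irreducible p) {j k : ℕ} (hkj : k ≤ j) :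
    residueCount p j {u | p ^ k ∣ u} = Nat.card (IsLocalRing.ResidueField A) ^ (j - k) := by
  have := residueCount_iUnion hp hkj (ι := Unit) (x := fun _ => 0) (fun _ _ _ => rfl)
  simpa using this

end ResidueCount

/-! ### The number of orders as a sum over Hermite forms -/

section Counting

variable {A K L : Type*} [CommRing A] [IsDomain A] [IsDiscreteValuationRing A]
  [Finite (IsLocalRing.ResidueField A)] [Field K] [Algebra A K] [IsFractionRing A K]
  [CommRing L] [Algebra K L] [Algebra A L] [IsScalarTower A K L] {a b c d : A} {ω θ : L}

/-- The number of traced orders is a sum of numbers of residue classes, over the possible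
Hermite normal forms. -/
theorem IsIndexFormBasis.ncard_tracedOrders (hL : Module.finrank K L = 3)
    (h : IsIndexFormBasis a b c d ω θ) {p : A} (hp : Irreducible p) {t d₀ n : ℕ} (h3 : p ^ t ∣ 3)
    (hD : Ideal.span {cubicFormDisc a b c d} = IsLocalRing.maximalIdeal A ^ d₀) :
    (tracedOrders A K L (IsLocalRing.maximalIdeal A ^ (d₀ + 2 * n))
        (IsLocalRing.maximalIdeal A ^ t)).Finite ∧
    (tracedOrders A K L (IsLocalRing.maximalIdeal A ^ (d₀ + 2 * n))
        (IsLocalRing.maximalIdeal A ^ t)).ncard =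
      ∑ j ∈ Finset.range (n + 1), residueCount p j
        {u | IsHermiteOrder a b c d p (n - j) j u ∧ IsHermiteTraced b c p t (n - j) j u} := by
  set S := tracedOrders A K L (IsLocalRing.maximalIdeal A ^ (d₀ + 2 * n))
    (IsLocalRing.maximalIdeal A ^ t) with hS
  set U : ℕ → Set A := fun j =>
    {u | IsHermiteOrder a b c d p (n - j) j u ∧ IsHermiteTraced b c p t (n - j) j u} with hU
  -- The chosen representative is harmless: the lattice depends only on its class modulo `p^j`.
  let g : ∀ j, A ⧸ Ideal.span {p ^ j} → Submodule A L := fun j x =>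
    hermiteLattice ω θ p (n - j) j (Quotient.out x)
  have hg : ∀ j u, g j (Ideal.Quotient.mk _ u) = hermiteLattice ω θ p (n - j) j u := by
    intro j u
    refine (h.hermiteLattice_eq_iff hp.prime rfl).2 ⟨rfl, ?_⟩
    rw [← mk_span_pow_eq_iff]
    exact Quotient.out_eq _
  have hginj : ∀ j, Function.Injective (g j) := by
    intro j x y e
    obtain ⟨u, rfl⟩ := Ideal.Quotient.mk_surjective x
    obtain ⟨v, rfl⟩ := Ideal.Quotient.mk_surjective y
    rw [hg, hg] at e
    exact mk_span_pow_eq_iff.2 ((h.hermiteLattice_eq_iff hp.prime rfl).1 e).2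
  have hfin : ∀ j, Finite (A ⧸ Ideal.span {p ^ j}) := finite_quotient_span_pow hp
  have himage : Subalgebra.toSubmodule '' S =
      ⋃ j ∈ ((Finset.range (n + 1) : Finset ℕ) : Set ℕ),
        g j '' (Ideal.Quotient.mk (Ideal.span {p ^ j}) '' U j) := by
    ext M
    simp only [Set.mem_iUnion, Finset.coe_range, Set.mem_Iio, exists_prop]
    constructor
    · rintro ⟨O, hO, rfl⟩
      obtain ⟨i, j, u, rfl, h1, h2, hOu⟩ := (h.mem_tracedOrders_iff hL hp h3 hD O).1 hO
      refine ⟨j, by omega, _, ⟨u, ?_, rfl⟩, ?_⟩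
      · simp only [hU, Set.mem_ofPred_eq, Nat.add_sub_cancel]
        exact ⟨h1, h2⟩
      · rw [hg, Nat.add_sub_cancel, hOu]
    · rintro ⟨j, hj, _, ⟨u, ⟨h1, h2⟩, rfl⟩, rfl⟩
      obtain ⟨O, hO⟩ := h.exists_subalgebra_eq_hermiteLattice hp.prime h1
      refine ⟨O, (h.mem_tracedOrders_iff hL hp h3 hD O).2 ⟨n - j, j, u, by omega, h1, h2, hO⟩, ?_⟩
      rw [hg, hO]
  have hfin' : ∀ j ∈ ((Finset.range (n + 1) : Finset ℕ) : Set ℕ),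
      (g j '' (Ideal.Quotient.mk (Ideal.span {p ^ j}) '' U j)).Finite := fun j _ =>
    ((Set.toFinite _).image _)
  have hinj : Function.Injective (Subalgebra.toSubmodule : Subalgebra A L → Submodule A L) :=
    Subalgebra.toSubmodule_injective
  constructor
  · refine Set.Finite.of_finite_image ?_ (hinj.injOn)
    rw [himage]
    exact Set.Finite.biUnion (Finset.finite_toSet _) hfin'
  · rw [← Set.ncard_image_of_injective S hinj, himage,
      Set.Finite.ncard_biUnion (Finset.finite_toSet _) hfin' ?_, finsum_mem_coe_finset]
    · exact Finset.sum_congr rfl fun j _ => Set.ncard_image_of_injective _ (hginj j)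
    · intro j hj j' hj' hjj'
      simp only [Finset.coe_range, Set.mem_Iio] at hj hj'
      refine Set.disjoint_left.2 ?_
      rintro _ ⟨_, ⟨u, -, rfl⟩, rfl⟩ ⟨_, ⟨v, -, rfl⟩, e⟩
      rw [hg, hg] at e
      exact hjj' ((h.hermiteLattice_eq_iff hp.prime (by omega)).1 e).1.symm

end Counting

/-! ### Solving the ring and trace conditions for `u` -/

section Conditions

variable {A : Type*} [CommRing A] [IsDomain A] [IsDiscreteValuationRing A] {p a b c d u : A}

lemma IsUnit.add_irreducible_mul {w : A} (hw : IsUnit w) (hp : Irreducible p) (x : A) :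
    IsUnit (w + p * x) := by
  by_contra H
  have h1 : w + p * x ∈ IsLocalRing.maximalIdeal A := H
  have h2 : p * x ∈ IsLocalRing.maximalIdeal A :=
    Ideal.mul_mem_right _ _ hp.not_isUnit
  have h3 := Ideal.sub_mem _ h1 h2
  rw [add_sub_cancel_right] at h3
  exact h3 hw

lemma dvd_of_not_isUnit (hp : Irreducible p) {x : A} (hx : ¬ IsUnit x) : p ∣ x := by
  have : x ∈ IsLocalRing.maximalIdeal A := hx
  rwa [hp.maximalIdeal_eq, Ideal.mem_span_singleton] at this

omit [IsDiscreteValuationRing A] in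
lemma pow_dvd_pow_mul_isUnit_iff (hp : Irreducible p) {w : A} (hw : IsUnit w) {m v : ℕ} :
    p ^ m ∣ p ^ v * w ↔ m ≤ v := by
  rw [hw.dvd_mul_right, pow_dvd_pow_iff hp.ne_zero hp.not_isUnit]

lemma pow_dvd_or_eq_pow_mul_isUnit (hp : Irreducible p) (u : A) (i : ℕ) :
    p ^ i ∣ u ∨ ∃ v w, v < i ∧ IsUnit w ∧ u = p ^ v * w := by
  by_cases hu : u = 0
  · exact .inl (hu ▸ dvd_zero _)
  obtain ⟨v, w, hw⟩ := IsDiscreteValuationRing.eq_unit_mul_pow_irreducible hu hp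
  rcases le_or_gt i v with h | h
  · exact .inl (hw ▸ (pow_dvd_pow p h).mul_left _)
  · exact .inr ⟨v, w, h, w.isUnit, by rw [hw, mul_comm]⟩

omit [IsDomain A] [IsDiscreteValuationRing A] in
lemma pow_dvd_of_eq_pow_mul {x y : A} {m v : ℕ} (h : m ≤ v) (hx : x = p ^ v * y) : p ^ m ∣ x :=
  hx ▸ (pow_dvd_pow p h).mul_right y

/-- The ring condition when `c` is a unit and `p ^ i ω` is deep compared to `p ^ j θ`. -/
lemma isHermiteOrder_iff_of_isUnit (hp : Irreducible p) {s : ℕ} (hs : s ≤ 1)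
    {a₀ : A} (ha₀ : IsUnit a₀) (ha : a = p ^ s * a₀) (hb : p ∣ b) {i j : ℕ} (hij : j ≤ 2 * i) :
    IsHermiteOrder a b c d p i j u ↔ (i + j + 2 - s) / 3 ≤ j ∧ p ^ ((i + j + 2 - s) / 3) ∣ u := by
  obtain ⟨b', rfl⟩ := hb
  subst ha
  constructor
  · rintro ⟨h1, -, h3⟩
    have h1' : i ≤ s + 2 * j := by
      rw [← pow_dvd_pow_mul_isUnit_iff hp ha₀]
      convert h1 using 1; ring
    refine ⟨by omega, ?_⟩
    rcases pow_dvd_or_eq_pow_mul_isUnit hp u i with h | ⟨v, w, hv, hw, rfl⟩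
    · exact (pow_dvd_pow p (by omega)).trans h
    · obtain ⟨r, rfl⟩ := Nat.exists_eq_add_of_lt hv
      -- If `v = v(u) < i`, then `a u³`, of valuation `3v + s`, is the unique leading term of `f(u,
      -- p^i)`. The exponent `(i + j + 2 - s) / 3` is `⌈(i + j - s) / 3⌉`.
      have : v + r + 1 + j ≤ 3 * v + s := by
        have hunit : IsUnit (a₀ * w ^ 3 + p * (p ^ (1 - s) *
            (p ^ r * b' * w ^ 2 + p ^ (2 * r) * c * w + p ^ (3 * r + 1) * d))) :=
          (ha₀.mul (hw.pow 3)).add_irreducible_mul hp _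
        rw [← pow_dvd_pow_mul_isUnit_iff hp hunit]
        convert h3 using 1
        interval_cases s <;> ring
      exact (pow_dvd_pow p (by omega)).mul_right w
  · rintro ⟨hk, w, hw⟩
    generalize hk' : (i + j + 2 - s) / 3 = k at *
    subst hw
    refine ⟨pow_dvd_of_eq_pow_mul (v := s + 2 * j) (y := a₀) (by omega) (by ring),
      pow_dvd_of_eq_pow_mul (v := s + 2 * k) (y := a₀ * w ^ 2) (by omega) (by ring),
      dvd_add (dvd_add (dvd_add
        (pow_dvd_of_eq_pow_mul (v := s + 3 * k) (y := a₀ * w ^ 3) (by omega) (by ring))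
        (pow_dvd_of_eq_pow_mul (v := 1 + 2 * k + i) (y := b' * w ^ 2) (by omega) (by ring)))
        (pow_dvd_of_eq_pow_mul (v := k + 2 * i) (y := c * w) (by omega) (by ring)))
        (pow_dvd_of_eq_pow_mul (v := 3 * i) (y := d) (by omega) (by ring))⟩

/-- If `v(u) < i`, the leading term `a u³` has valuation below `i + j`. Hence `u = p^i z`, and
`p^(3i)` cancels from the form condition. -/
lemma isHermiteOrder_iff_of_isUnit_of_lt (hp : Irreducible p) {s : ℕ} (hs : s ≤ 1)
    {a₀ : A} (ha₀ : IsUnit a₀) (ha : a = p ^ s * a₀) (hb : p ∣ b) {i j : ℕ} (hij : 2 * i < j) :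
    IsHermiteOrder a b c d p i j u ↔
      ∃ z, u = p ^ i * z ∧ p ^ (j - 2 * i) ∣ a * z ^ 3 + b * z ^ 2 + c * z + d := by
  obtain ⟨m, rfl⟩ := Nat.exists_eq_add_of_lt hij
  rw [show 2 * i + m + 1 - 2 * i = m + 1 by omega]
  constructor
  · rintro ⟨-, -, h3⟩
    rcases pow_dvd_or_eq_pow_mul_isUnit hp u i with ⟨z, rfl⟩ | ⟨v, w, hv, hw, rfl⟩
    · obtain ⟨y, hy⟩ := h3
      exact ⟨z, rfl, y, mul_left_cancel₀ (pow_ne_zero (3 * i) hp.ne_zero)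
        (by linear_combination hy)⟩
    · exfalso
      obtain ⟨b', rfl⟩ := hb
      subst ha
      obtain ⟨r, rfl⟩ := Nat.exists_eq_add_of_lt hv
      have hunit : IsUnit (a₀ * w ^ 3 + p * (p ^ (1 - s) *
          (p ^ r * b' * w ^ 2 + p ^ (2 * r) * c * w + p ^ (3 * r + 1) * d))) :=
        (ha₀.mul (hw.pow 3)).add_irreducible_mul hp _
      have := (pow_dvd_pow_mul_isUnit_iff hp hunit (m := v + r + 1 + (2 * (v + r + 1) + m + 1))
        (v := 3 * v + s)).1 (by
          convert h3 using 1
          interval_cases s <;> ring)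
      omega
  · rintro ⟨z, rfl, y, hy⟩
    refine ⟨pow_dvd_of_eq_pow_mul (v := 4 * i + 2 * m + 2) (y := a) (by omega) (by ring),
      pow_dvd_of_eq_pow_mul (v := 2 * i) (y := a * z ^ 2) (by omega) (by ring), y, ?_⟩
    linear_combination p ^ (3 * i) * hy

/-- The terms `a u³` and `d p^(3i)` have valuations `3 v(u)` and `3i + 1`, which are never equal,
and the middle terms lie above their minimum. So `f(u, p^i)` has valuation exactly `min(3 v(u), 3i +
1)`; the first is the smaller one when `v(u) ≤ i`. -/
lemma isHermiteOrder_iff_of_totRam (hp : Irreducible p) (ha : IsUnit a) (hb : p ∣ b) (hc : p ∣ c)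
    {d' : A} (hd' : IsUnit d') (hd : d = p * d') {i j : ℕ} :
    IsHermiteOrder a b c d p i j u ↔
      (i + j + 2) / 3 ≤ j ∧ i + j ≤ 3 * i + 1 ∧ p ^ ((i + j + 2) / 3) ∣ u := by
  obtain ⟨b', rfl⟩ := hb
  obtain ⟨c', rfl⟩ := hc
  subst hd
  constructor
  · rintro ⟨h1, -, h3⟩
    have h1' : i ≤ 2 * j := by
      rw [← pow_dvd_pow_mul_isUnit_iff hp ha]
      convert h1 using 1; ring
    refine ⟨by omega, ?_⟩
    rcases pow_dvd_or_eq_pow_mul_isUnit hp u (i + 1) with ⟨w, rfl⟩ | ⟨v, w, hv, hw, rfl⟩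
    · have hunit : IsUnit (d' + p * (p * a * w ^ 3 + p * b' * w ^ 2 + c' * w)) :=
        hd'.add_irreducible_mul hp _
      have : i + j ≤ 3 * i + 1 := by
        rw [← pow_dvd_pow_mul_isUnit_iff hp hunit]
        convert h3 using 1; ring
      exact ⟨this, (pow_dvd_pow p (by omega)).mul_right w⟩
    · obtain ⟨r, rfl⟩ := Nat.exists_eq_add_of_le (Nat.lt_succ_iff.1 hv)
      have hunit : IsUnit (a * w ^ 3 +
          p * (p ^ r * b' * w ^ 2 + p ^ (2 * r) * c' * w + p ^ (3 * r) * d')) :=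
        (ha.mul (hw.pow 3)).add_irreducible_mul hp _
      have : v + r + j ≤ 3 * v := by
        rw [← pow_dvd_pow_mul_isUnit_iff hp hunit]
        convert h3 using 1; ring
      exact ⟨by omega, (pow_dvd_pow p (by omega)).mul_right w⟩
  · rintro ⟨hk, hi, w, hw⟩
    generalize hk' : (i + j + 2) / 3 = k at *
    subst hw
    refine ⟨pow_dvd_of_eq_pow_mul (v := 2 * j) (y := a) (by omega) (by ring),
      pow_dvd_of_eq_pow_mul (v := 2 * k) (y := a * w ^ 2) (by omega) (by ring),
      dvd_add (dvd_add (dvd_add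
        (pow_dvd_of_eq_pow_mul (v := 3 * k) (y := a * w ^ 3) (by omega) (by ring))
        (pow_dvd_of_eq_pow_mul (v := 1 + 2 * k + i) (y := b' * w ^ 2) (by omega) (by ring)))
        (pow_dvd_of_eq_pow_mul (v := 1 + k + 2 * i) (y := c' * w) (by omega) (by ring)))
        (pow_dvd_of_eq_pow_mul (v := 1 + 3 * i) (y := d') (by omega) (by ring))⟩

omit [IsDomain A] [IsDiscreteValuationRing A] in
lemma isHermiteTraced_of_dvd {t : ℕ} (hb : p ^ t ∣ b) (hc : p ^ t ∣ c) (i j : ℕ) :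
    IsHermiteTraced b c p t i j u :=
  ⟨hb.mul_right _, (hb.mul_right _).sub (hc.mul_right _)⟩

omit [IsDiscreteValuationRing A] in
lemma isHermiteTraced_iff_of_dvd_fst (hp : Irreducible p) {t g : ℕ} (hb : p ^ t ∣ b) {c' : A}
    (hc' : IsUnit c') (hc : c = p ^ g * c') {i j : ℕ} :
    IsHermiteTraced b c p t i j u ↔ t ≤ g + i := by
  have key : p ^ t ∣ c * p ^ i ↔ t ≤ g + i := by
    rw [← pow_dvd_pow_mul_isUnit_iff hp hc', hc]
    ring_nf
  constructor
  · rintro ⟨-, h⟩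
    rw [← key]
    have := (hb.mul_right u).sub h
    rwa [sub_sub_cancel] at this
  · intro h
    exact ⟨hb.mul_right _, (hb.mul_right _).sub (key.2 h)⟩

omit [IsDiscreteValuationRing A] in
lemma isHermiteTraced_iff_of_dvd_snd (hp : Irreducible p) {t g : ℕ} (hc : p ^ t ∣ c) {b' : A}
    (hb' : IsUnit b') (hb : b = p ^ g * b') {i j : ℕ} :
    IsHermiteTraced b c p t i j u ↔ t ≤ g + j ∧ p ^ (t - g) ∣ u := by
  have key : p ^ t ∣ b * p ^ j ↔ t ≤ g + j := by
    rw [← pow_dvd_pow_mul_isUnit_iff hp hb', hb]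
    ring_nf
  have key' : p ^ t ∣ b * u ↔ p ^ (t - g) ∣ u := by
    rw [hb, show p ^ g * b' * u = (p ^ g * u) * b' by ring, hb'.dvd_mul_right]
    rcases le_total g t with h | h
    · obtain ⟨m, rfl⟩ := Nat.exists_eq_add_of_le h
      rw [pow_add, Nat.add_sub_cancel_left, mul_dvd_mul_iff_left (pow_ne_zero _ hp.ne_zero)]
    · rw [Nat.sub_eq_zero_of_le h, pow_zero]
      exact iff_of_true ((pow_dvd_pow p h).mul_right u) (one_dvd u)
  constructor
  · rintro ⟨h1, h2⟩
    refine ⟨key.1 h1, key'.1 ?_⟩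
    have := h2.add (hc.mul_right (p ^ i))
    rwa [sub_add_cancel] at this
  · rintro ⟨h1, h2⟩
    exact ⟨key.2 h1, (key'.2 h2).sub (hc.mul_right _)⟩

end Conditions

/-! ### Valuation of the discriminant -/

section Discriminant

variable {A : Type*} [CommRing A] [IsDomain A] [IsDiscreteValuationRing A] {p a b c d : A}

lemma eq_of_span_eq_maximalIdeal_pow (hp : Irreducible p) {D w : A} (hw : IsUnit w) {m d₀ : ℕ}
    (hm : D = p ^ m * w) (hD : Ideal.span {D} = IsLocalRing.maximalIdeal A ^ d₀) : d₀ = m := by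
  rw [hp.maximalIdeal_eq, Ideal.span_singleton_pow] at hD
  have h1 := Ideal.span_singleton_le_span_singleton.1 hD.le
  have h2 := Ideal.span_singleton_le_span_singleton.1 hD.ge
  rw [hm] at h1 h2
  refine le_antisymm ((pow_dvd_pow_mul_isUnit_iff hp hw).1 h1) ?_
  rw [← pow_dvd_pow_iff hp.ne_zero hp.not_isUnit]
  exact (dvd_mul_right _ _).trans h2

lemma isUnit_four (hp : Irreducible p) (h3 : p ∣ 3) : IsUnit (-4 : A) := by
  obtain ⟨x, hx⟩ := h3
  have : (-4 : A) = -(1 + p * x) := by rw [← hx]; norm_num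
  rw [this]
  exact (isUnit_one.add_irreducible_mul hp x).neg

/-- As `p` divides `3` and `b`, every term other than `-4 a c³` has valuation at least 2. -/
lemma disc_exponent_of_isUnit (hp : Irreducible p) (h3 : p ∣ 3) {s : ℕ} (hs : s ≤ 1)
    {a₀ : A} (ha₀ : IsUnit a₀) (ha : a = p ^ s * a₀) (hb : p ∣ b) (hc : IsUnit c) {d₀ : ℕ}
    (hD : Ideal.span {cubicFormDisc a b c d} = IsLocalRing.maximalIdeal A ^ d₀) : d₀ = s := by
  obtain ⟨b', rfl⟩ := hb
  have h4 := isUnit_four hp h3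
  obtain ⟨x, hx⟩ := h3
  refine eq_of_span_eq_maximalIdeal_pow hp
    (((h4.mul ha₀).mul (hc.pow 3)).add_irreducible_mul hp
      (p ^ (1 - s) * (b' ^ 2 * c ^ 2 - 4 * p * b' ^ 3 * d - 3 * x ^ 2 * a ^ 2 * d ^ 2
        + 2 * 3 * x * a * b' * c * d))) ?_ hD
  have e : p ^ s * p * p ^ (1 - s) = p ^ 2 := by interval_cases s <;> ring
  rw [cubicFormDisc]
  linear_combination (-4 * c ^ 3) * ha + (-3 * (3 + p * x) * a ^ 2 * d ^ 2
      + 2 * 3 * p * a * b' * c * d) * hx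
    - (b' ^ 2 * c ^ 2 - 4 * p * b' ^ 3 * d - 3 * x ^ 2 * a ^ 2 * d ^ 2
        + 2 * 3 * x * a * b' * c * d) * e

lemma le_disc_exponent_of_dvd (hp : Irreducible p) {t : ℕ} (h3 : p ^ t ∣ 3) (hb : p ^ t ∣ b)
    (hc : p ^ t ∣ c) {d₀ : ℕ}
    (hD : Ideal.span {cubicFormDisc a b c d} = IsLocalRing.maximalIdeal A ^ d₀) :
    3 * t ≤ d₀ := by
  rw [hp.maximalIdeal_eq, Ideal.span_singleton_pow] at hD
  rw [← pow_dvd_pow_iff hp.ne_zero hp.not_isUnit]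
  refine dvd_trans ?_ (Ideal.span_singleton_le_span_singleton.1 hD.ge)
  obtain ⟨x, hx⟩ := h3
  obtain ⟨b', rfl⟩ := hb
  obtain ⟨c', rfl⟩ := hc
  refine ⟨p ^ t * b' ^ 2 * c' ^ 2 - 4 * a * c' ^ 3 - 4 * b' ^ 3 * d - x ^ 3 * a ^ 2 * d ^ 2
    + 2 * x ^ 2 * p ^ t * a * b' * c' * d, ?_⟩
  rw [cubicFormDisc]
  linear_combination (-(9 + 3 * p ^ t * x + (p ^ t * x) ^ 2) * a ^ 2 * d ^ 2
    + 2 * (3 + p ^ t * x) * a * (p ^ t * b') * (p ^ t * c') * d) * hx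

/-- The leading term is `-4 a c³`. In the mirror case below it is `-4 b³ d`, where `d` contributes
the extra 1. -/
lemma disc_exponent_of_fst (hp : Irreducible p) {g : ℕ} (h3 : p ^ (g + 1) ∣ 3) (ha : IsUnit a)
    (hb : p ^ (g + 1) ∣ b) {c' : A} (hc' : IsUnit c') (hc : c = p ^ g * c') {d₀ : ℕ}
    (hD : Ideal.span {cubicFormDisc a b c d} = IsLocalRing.maximalIdeal A ^ d₀) :
    d₀ = 3 * g := by
  have h4 := isUnit_four hp (dvd_trans ⟨p ^ g, by ring⟩ h3)
  obtain ⟨x, hx⟩ := h3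
  obtain ⟨b', rfl⟩ := hb
  subst hc
  refine eq_of_span_eq_maximalIdeal_pow hp
    (((h4.mul ha).mul (hc'.pow 3)).add_irreducible_mul hp
      (p ^ (g + 1) * b' ^ 2 * c' ^ 2 - 4 * p ^ 2 * b' ^ 3 * d - p ^ 2 * x ^ 3 * a ^ 2 * d ^ 2
        + 2 * p ^ (g + 2) * x ^ 2 * a * b' * c' * d)) ?_ hD
  rw [cubicFormDisc]
  linear_combination (-(9 + 3 * (p ^ (g + 1) * x) + (p ^ (g + 1) * x) ^ 2) * a ^ 2 * d ^ 2
    + 2 * (3 + p ^ (g + 1) * x) * a * (p ^ (g + 1) * b') * (p ^ g * c') * d) * hx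

lemma disc_exponent_of_snd (hp : Irreducible p) {g : ℕ} (h3 : p ^ (g + 1) ∣ 3)
    (hc : p ^ (g + 1) ∣ c) {b' : A} (hb' : IsUnit b') (hb : b = p ^ g * b')
    {d' : A} (hd' : IsUnit d') (hd : d = p * d') {d₀ : ℕ}
    (hD : Ideal.span {cubicFormDisc a b c d} = IsLocalRing.maximalIdeal A ^ d₀) :
    d₀ = 3 * g + 1 := by
  have h4 := isUnit_four hp (dvd_trans ⟨p ^ g, by ring⟩ h3)
  obtain ⟨x, hx⟩ := h3
  obtain ⟨c', rfl⟩ := hc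
  subst hb hd
  refine eq_of_span_eq_maximalIdeal_pow hp
    (((h4.mul (hb'.pow 3)).mul hd').add_irreducible_mul hp
      (p ^ g * b' ^ 2 * c' ^ 2 - 4 * p * a * c' ^ 3 - p ^ 3 * x ^ 3 * a ^ 2 * d' ^ 2
        + 2 * p ^ (g + 2) * x ^ 2 * a * b' * c' * d')) ?_ hD
  rw [cubicFormDisc]
  linear_combination (-(9 + 3 * (p ^ (g + 1) * x) + (p ^ (g + 1) * x) ^ 2) * a ^ 2 * (p * d') ^ 2
    + 2 * (3 + p ^ (g + 1) * x) * a * (p ^ g * b') * (p ^ (g + 1) * c') * (p * d')) * hx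

end Discriminant

/-! ### Geometric sums -/

section Sums

lemma sum_range_ite_pow (q n k E : ℕ) (hE : E ≤ n + 1) :
    ∑ j ∈ Finset.range (n + 1), (if k ≤ j ∧ j < E then q ^ (j - k) else 0) =
      ∑ l ∈ Finset.range (E - k), q ^ l := by
  rw [← Finset.sum_filter, show (Finset.range (n + 1)).filter (fun j => k ≤ j ∧ j < E) =
    Finset.Ico k E by ext; simp; omega, Finset.sum_Ico_eq_sum_range]
  simp

lemma cast_sum_range_pow {q : ℕ} (hq : 1 < q) (r : ℕ) :
    ((∑ l ∈ Finset.range r, q ^ l : ℕ) : ℚ) = ((q : ℚ) ^ r - 1) / ((q : ℚ) - 1) := by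
  push_cast
  exact geom_sum_eq (by exact_mod_cast hq.ne') r

/-- In terms of `i = n - j`, the condition `2i < j` is `i < ⌈n/3⌉`. The maximum makes the range
empty when `t` exceeds that bound. -/
lemma cast_sum_range_ite_lt {q : ℕ} (hq : 1 < q) (n t : ℕ) :
    ((∑ j ∈ Finset.range (n + 1),
      (if t ≤ n - j ∧ 2 * (n - j) < j then q ^ (n - j) else 0) : ℕ) : ℚ) =
      ((q : ℚ) ^ max t ((n + 2) / 3) - (q : ℚ) ^ t) / ((q : ℚ) - 1) := by
  have h1 : ∑ j ∈ Finset.range (n + 1), (if t ≤ n - j ∧ 2 * (n - j) < j then q ^ (n - j) else 0) =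
      ∑ i ∈ Finset.Ico t (max t ((n + 2) / 3)), q ^ i := by
    rw [← Finset.sum_range_reflect, ← Finset.sum_subset (s₁ := Finset.Ico t (max t ((n + 2) / 3)))]
    · refine Finset.sum_congr rfl fun i hi => ?_
      rw [Finset.mem_Ico] at hi
      rw [if_pos (by omega)]
      congr 1
      omega
    · intro i hi
      rw [Finset.mem_Ico] at hi
      rw [Finset.mem_range]; omega
    · intro i hi hi'
      rw [Finset.mem_range] at hi
      rw [Finset.mem_Ico] at hi'
      rw [if_neg]
      omega
  rw [h1]
  push_cast
  exact geom_sum_Ico (by exact_mod_cast hq.ne') (le_max_left _ _)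

end Sums

/-! ### Hensel lifting of roots of `f(z, 1)` -/

section Roots

variable {A : Type*} [CommRing A] [IsDomain A] [IsDiscreteValuationRing A] {p a b c d : A}

/-- The roots in the residue field of the cubic polynomial `a z ^ 3 + b z ^ 2 + c z + d`. -/
def ResidueRoots (a b c d : A) : Type _ :=
  {z : IsLocalRing.ResidueField A // IsLocalRing.residue A a * z ^ 3 + IsLocalRing.residue A b * z ^ 2
    + IsLocalRing.residue A c * z + IsLocalRing.residue A d = 0}

lemma residue_eq_zero_iff_dvd (hp : Irreducible p) {x : A} :
    IsLocalRing.residue A x = 0 ↔ p ∣ x := by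
  rw [IsLocalRing.residue_eq_zero_iff, hp.maximalIdeal_eq, Ideal.mem_span_singleton]

lemma residue_eq_iff_dvd (hp : Irreducible p) {x y : A} :
    IsLocalRing.residue A x = IsLocalRing.residue A y ↔ p ∣ x - y := by
  rw [← sub_eq_zero, ← map_sub, residue_eq_zero_iff_dvd hp]

/-- The derivative `3 a z² + 2 b z + c` is congruent to the unit `c` modulo `p`, so Newton's step
with `c` in place of the derivative suffices. -/
lemma exists_lift_root (hp : Irreducible p) (h3 : p ∣ 3) (hb : p ∣ b) (hc : IsUnit c)
    (m : ℕ) (z : ResidueRoots a b c d) :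
    ∃ x, IsLocalRing.residue A x = z.1 ∧ p ^ (m + 1) ∣ a * x ^ 3 + b * x ^ 2 + c * x + d := by
  induction m with
  | zero =>
    obtain ⟨x, hx⟩ := IsLocalRing.residue_surjective z.1
    refine ⟨x, hx, ?_⟩
    rw [zero_add, pow_one, ← residue_eq_zero_iff_dvd hp]
    simpa [hx] using z.2
  | succ m ih =>
    obtain ⟨x, hx, y, hy⟩ := ih
    obtain ⟨e, he⟩ := h3
    obtain ⟨b', rfl⟩ := hb
    obtain ⟨c, rfl⟩ := hc
    have hcc : (c : A) * ↑c⁻¹ = 1 := c.mul_inv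
    generalize (↑c⁻¹ : A) = γ at hcc
    refine ⟨x - p ^ (m + 1) * (y * γ), ?_, ?_⟩
    · rw [← hx, residue_eq_iff_dvd hp]
      exact ⟨-p ^ m * (y * γ), by ring⟩
    · set v := y * γ with hv
      refine ⟨-(e * a * x ^ 2 * v) - 2 * b' * x * v + 3 * a * x * p ^ m * v ^ 2
        + p * b' * p ^ m * v ^ 2 - a * p ^ (2 * m + 1) * v ^ 3, ?_⟩
      linear_combination hy - p ^ (m + 1) * y * hcc - p ^ (m + 1) * a * x ^ 2 * v * he
        - p ^ (m + 1) * c * hv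

/-- Uniqueness of the lift: the two values differ by `z - x` times a unit congruent to `c`. -/
lemma form_dvd_iff (hp : Irreducible p) (h3 : p ∣ 3) (hb : p ∣ b) (hc : IsUnit c)
    {m : ℕ} {x z : A} (hx : p ^ (m + 1) ∣ a * x ^ 3 + b * x ^ 2 + c * x + d) (hxz : p ∣ z - x) :
    p ^ (m + 1) ∣ a * z ^ 3 + b * z ^ 2 + c * z + d ↔ p ^ (m + 1) ∣ z - x := by
  rw [← dvd_sub_left hx]
  obtain ⟨e, he⟩ := h3
  obtain ⟨b', rfl⟩ := hb
  obtain ⟨v, hv⟩ := hxz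
  have hunit : IsUnit (c + p * (e * a * x ^ 2 + 3 * a * x * v + p * a * v ^ 2 + b' * (z + x))) :=
    hc.add_irreducible_mul hp _
  rw [← hunit.dvd_mul_right (b := z - x)]
  have : a * z ^ 3 + p * b' * z ^ 2 + c * z + d - (a * x ^ 3 + p * b' * x ^ 2 + c * x + d) =
    (z - x) * (c + p * (e * a * x ^ 2 + 3 * a * x * v + p * a * v ^ 2 + b' * (z + x))) := by
    obtain rfl : z = x + p * v := by linear_combination hv
    linear_combination p * v * a * x ^ 2 * he
  rw [this]

end Roots

/-! ### Summing the residue counts -/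

section Count

variable {A : Type*} [CommRing A] [IsDomain A] [IsDiscreteValuationRing A]
  [Finite (IsLocalRing.ResidueField A)] {p a b c d : A}

omit [Finite (IsLocalRing.ResidueField A)] in
-- A root lifts uniquely modulo `p^(j-2i)`, so `u = p^i z` is fixed modulo `p^(j-i)`, leaving `q^i`
-- classes modulo `p^j`.
lemma residueCount_of_roots (hp : Irreducible p) (h3 : p ∣ 3) (hb : p ∣ b) (hc : IsUnit c)
    {i j : ℕ} (hij : 2 * i < j) :
    residueCount p j
      {u | ∃ z, u = p ^ i * z ∧ p ^ (j - 2 * i) ∣ a * z ^ 3 + b * z ^ 2 + c * z + d} =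
      Nat.card (ResidueRoots a b c d) * Nat.card (IsLocalRing.ResidueField A) ^ i := by
  obtain ⟨m, rfl⟩ := Nat.exists_eq_add_of_lt hij
  rw [show 2 * i + m + 1 - 2 * i = m + 1 by omega]
  choose x hx hx' using exists_lift_root (a := a) (d := d) hp h3 hb hc m
  have hinj : ∀ z w, p ^ (i + m + 1) ∣ p ^ i * x z - p ^ i * x w → z = w := by
    rintro z w ⟨y, hy⟩
    refine Subtype.ext ?_
    rw [← hx, ← hx, residue_eq_iff_dvd hp]
    exact ⟨p ^ m * y, mul_left_cancel₀ (pow_ne_zero i hp.ne_zero) (by linear_combination hy)⟩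
  have := residueCount_iUnion hp (j := 2 * i + m + 1) (k := i + m + 1) (by omega) hinj
  rw [show 2 * i + m + 1 - (i + m + 1) = i by omega] at this
  rw [← this]
  congr 1
  ext u
  constructor
  · rintro ⟨z, rfl, hz⟩
    have hroot : IsLocalRing.residue A a * IsLocalRing.residue A z ^ 3 +
        IsLocalRing.residue A b * IsLocalRing.residue A z ^ 2
        + IsLocalRing.residue A c * IsLocalRing.residue A z + IsLocalRing.residue A d = 0 := by
      have : p ∣ a * z ^ 3 + b * z ^ 2 + c * z + d := dvd_trans ⟨p ^ m, by ring⟩ hz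
      rw [← residue_eq_zero_iff_dvd hp] at this
      simpa using this
    refine ⟨⟨_, hroot⟩, ?_⟩
    have hzx := (form_dvd_iff hp h3 hb hc (hx' ⟨_, hroot⟩)
      ((residue_eq_iff_dvd hp).1 (hx ⟨_, hroot⟩).symm)).1 hz
    rw [← mul_sub, show i + m + 1 = i + (m + 1) by ring, pow_add]
    exact mul_dvd_mul_left _ hzx
  · rintro ⟨z, w, hw⟩
    refine ⟨x z + p ^ (m + 1) * w, by linear_combination hw, ?_⟩
    rw [form_dvd_iff hp h3 hb hc (hx' z)]
    · exact ⟨w, by ring⟩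
    · exact ⟨p ^ m * w, by ring⟩

/-- The sum of the numbers of Hermite normal forms, if `c` is a unit. -/
lemma sum_residueCount_of_isUnit (hp : Irreducible p) (h3 : p ∣ 3) {s : ℕ} (hs : s ≤ 1)
    {a₀ : A} (ha₀ : IsUnit a₀) (ha : a = p ^ s * a₀) (hb : p ∣ b) (hc : IsUnit c) {t : ℕ}
    (hbt : p ^ t ∣ b) (n : ℕ) :
    ((∑ j ∈ Finset.range (n + 1), residueCount p j
        {u | IsHermiteOrder a b c d p (n - j) j u ∧ IsHermiteTraced b c p t (n - j) j u} : ℕ) : ℚ) =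
      ((Nat.card (IsLocalRing.ResidueField A) : ℚ) ^
          (min (n + 1 - t) (2 * n / 3 + 1) - (n + 2 - s) / 3) - 1) /
          ((Nat.card (IsLocalRing.ResidueField A) : ℚ) - 1) +
        Nat.card (ResidueRoots a b c d) *
          (((Nat.card (IsLocalRing.ResidueField A) : ℚ) ^ max t ((n + 2) / 3) -
            (Nat.card (IsLocalRing.ResidueField A) : ℚ) ^ t) /
            ((Nat.card (IsLocalRing.ResidueField A) : ℚ) - 1)) := by
  have hq : 1 < Nat.card (IsLocalRing.ResidueField A) := Finite.one_lt_card
  -- The upper limit `min (n + 1 - t) (2n/3 + 1)` encodes `i ≥ t` and `j ≤ 2i`; the second sum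
  -- covers `j > 2i`.
  rw [← cast_sum_range_pow hq, ← cast_sum_range_ite_lt hq,
    ← sum_range_ite_pow _ n ((n + 2 - s) / 3) _ (by omega), ← Nat.cast_mul, ← Nat.cast_add,
    Finset.mul_sum, ← Finset.sum_add_distrib, Nat.cast_inj]
  refine Finset.sum_congr rfl fun j hj => ?_
  obtain ⟨i, rfl⟩ := Nat.exists_eq_add_of_le (Nat.lt_succ_iff.1 (Finset.mem_range.1 hj))
  have htr : ∀ u, IsHermiteTraced b c p t i j u ↔ t ≤ i := fun u => by
    rw [isHermiteTraced_iff_of_dvd_fst hp (g := 0) hbt hc (by simp), zero_add]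
  simp only [Nat.add_sub_cancel_left, htr]
  by_cases ht : t ≤ i
  · rcases le_or_gt j (2 * i) with h | h
    · simp only [isHermiteOrder_iff_of_isUnit hp hs ha₀ ha hb h, ht, and_true, true_and]
      rw [if_neg (c := 2 * i < j) (by omega), mul_zero, add_zero, add_comm i j]
      by_cases hk : (j + i + 2 - s) / 3 ≤ j
      · simp only [hk, true_and]
        rw [residueCount_dvd hp hk, if_pos]
        omega
      · simp only [hk, false_and]
        exact residueCount_empty _ _
    · simp only [isHermiteOrder_iff_of_isUnit_of_lt hp hs ha₀ ha hb h, ht, and_true, true_and]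
      rw [residueCount_of_roots hp h3 hb hc h, if_neg, if_pos h, zero_add]
      omega
  · simp only [ht, and_false, false_and]
    rw [if_neg, if_neg not_false, mul_zero]
    · exact residueCount_empty _ _
    · omega

omit [IsDomain A] [IsDiscreteValuationRing A]
  [Finite (IsLocalRing.ResidueField A)] in
lemma residueCount_and_dvd {j k k' : ℕ} :
    residueCount p j {u | p ^ k ∣ u ∧ p ^ k' ∣ u} = residueCount p j {u | p ^ max k k' ∣ u} := by
  congr 1
  ext u
  constructor
  · rintro ⟨h1, h2⟩
    rcases max_choice k k' with h | h <;> simpa only [Set.mem_ofPred_eq, h]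
  · intro h
    exact ⟨(pow_dvd_pow p (le_max_left _ _)).trans h, (pow_dvd_pow p (le_max_right _ _)).trans h⟩

/-- The sum of the numbers of Hermite normal forms, if the form is totally ramified and the trace
conditions are bounds on `j` and `u`. -/
lemma sum_residueCount_of_totRam (hp : Irreducible p) (ha : IsUnit a) (hb : p ∣ b) (hc : p ∣ c)
    {d' : A} (hd' : IsUnit d') (hd : d = p * d') {n t l E : ℕ} (hE : E ≤ n + 1)
    (htr : ∀ i j u, i + j = n → (IsHermiteTraced b c p t i j u ↔ j < E ∧ l ≤ j ∧ p ^ l ∣ u)) :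
    ((∑ j ∈ Finset.range (n + 1), residueCount p j
        {u | IsHermiteOrder a b c d p (n - j) j u ∧ IsHermiteTraced b c p t (n - j) j u} : ℕ) : ℚ) =
      ((Nat.card (IsLocalRing.ResidueField A) : ℚ) ^
          (min E ((2 * n + 1) / 3 + 1) - max ((n + 2) / 3) l) - 1) /
          ((Nat.card (IsLocalRing.ResidueField A) : ℚ) - 1) := by
  have hq : 1 < Nat.card (IsLocalRing.ResidueField A) := Finite.one_lt_card
  -- With `i = n - j`, the bound `n ≤ 3i + 1` reads `j ≤ ⌊(2n + 1)/3⌋`.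
  rw [← cast_sum_range_pow hq, ← sum_range_ite_pow _ n (max ((n + 2) / 3) l) _ (by omega),
    Nat.cast_inj]
  refine Finset.sum_congr rfl fun j hj => ?_
  obtain ⟨i, rfl⟩ := Nat.exists_eq_add_of_le (Nat.lt_succ_iff.1 (Finset.mem_range.1 hj))
  simp only [Nat.add_sub_cancel_left, htr i j _ (add_comm i j),
    isHermiteOrder_iff_of_totRam hp ha hb hc hd' hd]
  rw [add_comm i j]
  split_ifs with h
  · rw [← residueCount_dvd hp h.1, ← residueCount_and_dvd]
    congr 1
    ext u
    simp only [Set.mem_ofPred_eq]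
    constructor
    · rintro ⟨⟨-, -, h1⟩, -, -, h2⟩
      exact ⟨h1, h2⟩
    · rintro ⟨h1, h2⟩
      exact ⟨⟨by omega, by omega, h1⟩, by omega, by omega, h2⟩
  · rw [← residueCount_empty p j]
    congr 1
    ext u
    simp only [Set.mem_ofPred_eq, Set.mem_empty_iff_false, iff_false]
    rintro ⟨⟨h1, h2, -⟩, h3, h4, -⟩
    omega

end Count

/-- The index form is a unit multiple of a cube modulo `p`, in Eisenstein position. -/
structure IsTotRamForm {A : Type*} [CommRing A] (p a b c d : A) : Prop where
  isUnit : IsUnit a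
  dvd_snd : p ∣ b
  dvd_trd : p ∣ c
  exists_eq : ∃ d' : A, IsUnit d' ∧ d = p * d'

/-- The index form is not a multiple of a cube modulo `p`; `s` is the valuation of its
discriminant. -/
structure IsTameForm {A : Type*} [CommRing A] (p a b c : A) (s : ℕ) : Prop where
  isUnit : IsUnit c
  dvd_snd : 3 ∣ b
  le_one : s ≤ 1
  exists_eq : ∃ a' : A, IsUnit a' ∧ a = p ^ s * a'

/-! ### Matching the counted ranges with the stated exponents -/

section Exponents

lemma exists_eq_three_mul_add (n : ℕ) :
    ∃ m, n = 3 * m ∨ n = 3 * m + 1 ∨ n = 3 * m + 2 := ⟨n / 3, by omega⟩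

lemma rTotRam_of_le {d₀ t n : ℕ} (h : 3 * t ≤ d₀) :
    rTotRam d₀ (d₀ + 2 * n) t = min (n + 1) ((2 * n + 1) / 3 + 1) - max ((n + 2) / 3) 0 := by
  rw [rTotRam]
  obtain ⟨m, rfl | rfl | rfl⟩ := exists_eq_three_mul_add n <;> split_ifs <;> omega

lemma rTotRam_three_mul {g t n : ℕ} (h : g < t) :
    rTotRam (3 * g) (3 * g + 2 * n) t =
      min (n + 1 - (t - g)) ((2 * n + 1) / 3 + 1) - max ((n + 2) / 3) 0 := by
  rw [rTotRam]
  obtain ⟨m, rfl | rfl | rfl⟩ := exists_eq_three_mul_add n <;> split_ifs <;> omega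

lemma rTotRam_three_mul_add_one {g t n : ℕ} (h : g < t) :
    rTotRam (3 * g + 1) (3 * g + 1 + 2 * n) t =
      min (n + 1) ((2 * n + 1) / 3 + 1) - max ((n + 2) / 3) (t - g) := by
  rw [rTotRam]
  obtain ⟨m, rfl | rfl | rfl⟩ := exists_eq_three_mul_add n <;> split_ifs <;> omega

lemma rInert_zero_add (n t : ℕ) :
    rInert (0 + 2 * n) t = min (n + 1 - t) (2 * n / 3 + 1) - (n + 2 - 0) / 3 := by
  rw [rInert]
  obtain ⟨m, rfl | rfl | rfl⟩ := exists_eq_three_mul_add n <;> split_ifs <;> omega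

lemma rTotRam_one_add (n t : ℕ) :
    rTotRam 1 (1 + 2 * n) t = min (n + 1 - t) (2 * n / 3 + 1) - (n + 2 - 1) / 3 := by
  rw [rTotRam]
  obtain ⟨m, rfl | rfl | rfl⟩ := exists_eq_three_mul_add n <;> split_ifs <;> omega

end Exponents

/-! ### Reduction to normal form -/

section NormalForm

variable {A K L : Type*} [CommRing A] [IsDomain A] [IsDiscreteValuationRing A]
  [Field K] [Algebra A K] [IsFractionRing A K]
  [CommRing L] [Algebra K L] [Algebra A L] [IsScalarTower A K L] {p a b c d : A} {ω θ : L}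

namespace IsIndexFormBasis

include K in
-- The shear by `μ = b / c` turns `b` into `b + 2b + 3 d μ²`, a multiple of 3.
lemma exists_isTameForm_of_isUnit (h : IsIndexFormBasis a b c d ω θ) (hp : Irreducible p)
    (h3 : p ∣ 3) (hc : IsUnit c) :
    ∃ (a b c d : A) (ω θ : L) (s : ℕ), IsIndexFormBasis a b c d ω θ ∧ IsTameForm p a b c s := by
  obtain ⟨c, rfl⟩ := hc
  have hcc : (c : A) * ↑c⁻¹ = 1 := c.mul_inv
  have h' := h.shear (b * ↑c⁻¹)
  set μ := b * (↑c⁻¹ : A) with hμ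
  obtain ⟨e, he⟩ := h3
  have hb : 3 ∣ b + 2 * c * μ + 3 * d * μ ^ 2 := ⟨b + d * μ ^ 2, by
    rw [hμ]; linear_combination 2 * b * hcc⟩
  have hc : IsUnit ((c : A) + 3 * d * μ) := by
    rw [he, mul_assoc, mul_assoc]
    exact c.isUnit.add_irreducible_mul hp _
  -- If `p²` divided the new leading coefficient, `ω / p` would be integral.
  rcases pow_dvd_or_eq_pow_mul_isUnit hp (a + b * μ + c * μ ^ 2 + d * μ ^ 3) 2 with
    hd | ⟨v, w, hv, hw, hvw⟩
  · exact (h'.not_dvd (K := K) hp.prime (dvd_trans ⟨e, he⟩ hb) (hd.mul_right _)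
      (Dvd.dvd.mul_right ((pow_dvd_pow p (by norm_num : 3 ≤ 4)).trans
        (by have := pow_dvd_pow_of_dvd hd 2; rwa [← pow_mul] at this)) _)).elim
  · exact ⟨_, _, _, _, _, _, v, h', hc, hb, by omega, w, hw, hvw⟩

include K in
-- Modulo `p` the form is `a x³ + d y³`. Cubing is bijective on a finite field of characteristic 3,
-- so a translation by a cube root of `-d/a` makes `p` divide `d`; maximality excludes `p² ∣ d`.
lemma exists_isTotRamForm_of_isUnit [Finite (IsLocalRing.ResidueField A)]
    [CharP (IsLocalRing.ResidueField A) 3]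
    (h : IsIndexFormBasis a b c d ω θ) (hp : Irreducible p)
    (ha : IsUnit a) (hb : p ∣ b) (hc : p ∣ c) :
    ∃ (a b c d : A) (ω θ : L), IsIndexFormBasis a b c d ω θ ∧ IsTotRamForm p a b c d := by
  have : Fact (Nat.Prime 3) := ⟨Nat.prime_three⟩
  have : ExpChar (IsLocalRing.ResidueField A) 3 := ExpChar.prime Nat.prime_three
  have h3 : p ∣ 3 := by
    rw [← residue_eq_zero_iff_dvd hp]
    rw [map_ofNat]
    exact_mod_cast CharP.cast_eq_zero (IsLocalRing.ResidueField A) 3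
  obtain ⟨μ, hμ⟩ : ∃ μ : A, p ∣ d + a * μ ^ 3 := by
    have hbij : Function.Surjective (frobenius (IsLocalRing.ResidueField A) 3) :=
      Finite.surjective_of_injective (frobenius_inj _ 3)
    have ha' : IsLocalRing.residue A a ≠ 0 := by
      rw [Ne, residue_eq_zero_iff_dvd hp]
      exact fun H => hp.not_isUnit (isUnit_of_dvd_unit H ha)
    obtain ⟨m, hm⟩ := hbij (-(IsLocalRing.residue A d / IsLocalRing.residue A a))
    obtain ⟨μ, rfl⟩ := IsLocalRing.residue_surjective m
    refine ⟨μ, ?_⟩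
    rw [← residue_eq_zero_iff_dvd hp]
    rw [frobenius_def] at hm
    simp only [map_add, map_mul, map_pow, hm]
    field_simp
    ring
  obtain ⟨ω', θ', h'⟩ := h.exists_shear' μ
  have hb' : p ∣ b + 3 * a * μ := hb.add ((h3.mul_right _).mul_right _)
  have hc' : p ∣ c + 2 * b * μ + 3 * a * μ ^ 2 :=
    (hc.add ((hb.mul_left _).mul_right _)).add ((h3.mul_right _).mul_right _)
  have hd' : p ∣ d + c * μ + b * μ ^ 2 + a * μ ^ 3 := by
    have := (hμ.add (hc.mul_right μ)).add (hb.mul_right (μ ^ 2))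
    convert this using 1; ring
  refine ⟨_, _, _, _, _, _, h', ha, hb', hc', ?_⟩
  obtain ⟨d', hd''⟩ := hd'
  refine ⟨d', ?_, hd''⟩
  by_contra H
  have hd2 : p ^ 2 ∣ d + c * μ + b * μ ^ 2 + a * μ ^ 3 := by
    rw [hd'', pow_two]
    exact mul_dvd_mul_left _ (dvd_of_not_isUnit hp H)
  refine h'.swap.not_dvd (K := K) hp.prime (hc'.neg_right) ?_ ?_
  · rw [neg_mul_neg]; exact hd2.mul_right _
  · rw [neg_sq]
    refine Dvd.dvd.mul_right ?_ _
    exact (pow_dvd_pow p (by norm_num : 3 ≤ 4)).trans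
      (by have := pow_dvd_pow_of_dvd hd2 2; rwa [← pow_mul] at this)

include K in
-- A unit middle coefficient leads to the tame case. Otherwise an outer coefficient is a unit, since
-- a form divisible by `p` contradicts maximality.
lemma exists_normalForm [Finite (IsLocalRing.ResidueField A)]
    [CharP (IsLocalRing.ResidueField A) 3]
    (h : IsIndexFormBasis a b c d ω θ) (hp : Irreducible p) (h3 : p ∣ 3) :
    (∃ (a b c d : A) (ω θ : L), IsIndexFormBasis a b c d ω θ ∧ IsTotRamForm p a b c d) ∨
    (∃ (a b c d : A) (ω θ : L) (s : ℕ), IsIndexFormBasis a b c d ω θ ∧ IsTameForm p a b c s) := by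
  by_cases hc : IsUnit c
  · exact .inr (h.exists_isTameForm_of_isUnit (K := K) hp h3 hc)
  by_cases hb : IsUnit b
  · exact .inr (h.swap.exists_isTameForm_of_isUnit (K := K) hp h3 hb.neg)
  have hc' := dvd_of_not_isUnit hp hc
  have hb' := dvd_of_not_isUnit hp hb
  by_cases ha : IsUnit a
  · exact .inl (h.exists_isTotRamForm_of_isUnit (K := K) hp ha hb' hc')
  by_cases hd : IsUnit d
  · exact .inl (h.swap.exists_isTotRamForm_of_isUnit (K := K) hp hd.neg hc'.neg_right hb'.neg_right)
  have ha' := dvd_of_not_isUnit hp ha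
  have hd' := dvd_of_not_isUnit hp hd
  refine (h.not_dvd (K := K) hp.prime hb' ?_ ?_).elim
  · rw [pow_two]; exact mul_dvd_mul ha' hc'
  · rw [pow_succ]; exact mul_dvd_mul (pow_dvd_pow_of_dvd ha' 2) hd'

/-- A totally ramified form can be moved so that one of its middle coefficients is divisible by
`p ^ t`, and the other one determines the discriminant if it is not divisible by `p ^ t`. -/
lemma exists_isTotRamForm_dvd (h : IsIndexFormBasis a b c d ω θ) (hp : Irreducible p)
    (hf : IsTotRamForm p a b c d) (hp3 : p ∣ 3) {t : ℕ} (h3 : p ^ t ∣ 3) :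
    ∃ (a b c d : A) (ω θ : L), IsIndexFormBasis a b c d ω θ ∧ IsTotRamForm p a b c d ∧
      ((p ^ t ∣ b ∧ p ^ t ∣ c) ∨
      (p ^ t ∣ b ∧ ∃ g < t, ∃ c', IsUnit c' ∧ c = p ^ g * c') ∨
      (p ^ t ∣ c ∧ ∃ g < t, ∃ b', IsUnit b' ∧ b = p ^ g * b')) := by
  obtain ⟨ha, hb, hc, d', hd', hd⟩ := hf
  -- the case in which the valuation of `c` is at most that of `b`
  have case1 : ∀ g w κ, g < t → IsUnit w → c = p ^ g * w → b = c * κ →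
      ∃ (a b c d : A) (ω θ : L), IsIndexFormBasis a b c d ω θ ∧ IsTotRamForm p a b c d ∧
      ((p ^ t ∣ b ∧ p ^ t ∣ c) ∨
      (p ^ t ∣ b ∧ ∃ g < t, ∃ c', IsUnit c' ∧ c = p ^ g * c') ∨
      (p ^ t ∣ c ∧ ∃ g < t, ∃ b', IsUnit b' ∧ b = p ^ g * b')) := by
    -- Shearing by `κ = b / c` replaces `b` by `3 (b + d κ²)`, and changes `c` only by a multiple of
    -- 3.
    intro g w κ hg hw hcw hκ
    obtain ⟨e, he⟩ := (pow_dvd_pow p (show g + 1 ≤ t from hg)).trans h3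
    have hbt : p ^ t ∣ b + 2 * c * κ + 3 * d * κ ^ 2 :=
      h3.trans ⟨b + d * κ ^ 2, by linear_combination -2 * hκ⟩
    refine ⟨_, _, _, _, _, _, h.shear κ, ⟨?_, ?_, ?_, d', hd', hd⟩, .inr (.inl ⟨hbt, g, hg,
      w + p * (e * d * κ), hw.add_irreducible_mul hp _, ?_⟩)⟩
    · obtain ⟨b', rfl⟩ := hb
      obtain ⟨c', rfl⟩ := hc
      have := ha.add_irreducible_mul hp (b' * κ + c' * κ ^ 2 + d' * κ ^ 3)
      rw [hd]
      convert this using 1; ring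
    · exact (dvd_pow_self p (by omega)).trans hbt
    · exact hc.add ((hp3.mul_right _).mul_right _)
    · linear_combination hcw + d * κ * he
  rcases pow_dvd_or_eq_pow_mul_isUnit hp b t with hbt | ⟨v, w, hv, hw, hb'⟩
  · rcases pow_dvd_or_eq_pow_mul_isUnit hp c t with hct | ⟨v', w', hv', hw', hc'⟩
    · exact ⟨a, b, c, d, ω, θ, h, ⟨ha, hb, hc, d', hd', hd⟩, .inl ⟨hbt, hct⟩⟩
    · obtain ⟨κ, hκ⟩ : c ∣ b := by
        rw [hc', hw'.mul_right_dvd]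
        exact (pow_dvd_pow p hv'.le).trans hbt
      exact case1 v' w' κ hv' hw' hc' hκ
  · rcases pow_dvd_or_eq_pow_mul_isUnit hp c (v + 1) with hcv | ⟨v', w', hv', hw', hc'⟩
    -- Here `v(c) > v(b)`, and the transposed shear by `p κ = c / b` replaces `c` by a multiple of
    -- 3. Its parameter is divisible by `p`, so the last coefficient keeps valuation 1.
    · obtain ⟨κ, hκ⟩ : p * b ∣ c := by
        rw [hb', ← mul_assoc, hw.mul_right_dvd, ← pow_succ']
        exact hcv
      obtain ⟨e, he⟩ := (pow_dvd_pow p (show v + 1 ≤ t from hv)).trans h3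
      obtain ⟨ω', θ', h'⟩ := h.exists_shear' (p * κ)
      have hct : p ^ t ∣ c + 2 * b * (p * κ) + 3 * a * (p * κ) ^ 2 :=
        h3.trans ⟨c + a * (p * κ) ^ 2, by linear_combination -2 * hκ⟩
      refine ⟨_, _, _, _, _, _, h', ⟨ha, ?_, ?_, ?_⟩, .inr (.inr ⟨hct, v, hv,
        w + p * (e * a * (p * κ)), hw.add_irreducible_mul hp _, ?_⟩)⟩
      · exact hb.add ((hp3.mul_right _).mul_right _)
      · exact (dvd_pow_self p (by omega)).trans hct
      · obtain ⟨c', rfl⟩ := hc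
        refine ⟨_, hd'.add_irreducible_mul hp (c' * κ + b * κ ^ 2 + a * p * κ ^ 3), ?_⟩
        linear_combination hd
      · linear_combination hb' + a * (p * κ) * he
    · obtain ⟨κ, hκ⟩ : c ∣ b := by
        rw [hc', hw'.mul_right_dvd, hb']
        exact (pow_dvd_pow p (by omega)).mul_right _
      exact case1 v' w' κ (by omega) hw' hc' hκ

end IsIndexFormBasis

end NormalForm

/-! ### The count for each normal form -/

section Count

variable {A K L : Type*} [CommRing A] [IsDomain A] [IsDiscreteValuationRing A]
  [Finite (IsLocalRing.ResidueField A)] [Field K] [Algebra A K] [IsFractionRing A K]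
  [CommRing L] [Algebra K L] [Algebra A L] [IsScalarTower A K L] {p a b c d : A} {ω θ : L}

theorem IsIndexFormBasis.ncard_of_isTotRamForm (hL : Module.finrank K L = 3)
    (h : IsIndexFormBasis a b c d ω θ) (hp : Irreducible p) (hf : IsTotRamForm p a b c d)
    (hp3 : p ∣ 3) {t d₀ n : ℕ} (h3 : p ^ t ∣ 3)
    (hD : cubicDiscIdeal A (integralClosure A L) = IsLocalRing.maximalIdeal A ^ d₀) :
    ((tracedOrders A K L (IsLocalRing.maximalIdeal A ^ (d₀ + 2 * n))
        (IsLocalRing.maximalIdeal A ^ t)).ncard : ℚ) =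
      gTotRam (Nat.card (IsLocalRing.ResidueField A)) d₀ (d₀ + 2 * n) t := by
  obtain ⟨a, b, c, d, ω, θ, h, ⟨ha, hb, hc, d', hd', hd⟩, hcases⟩ :=
    h.exists_isTotRamForm_dvd hp hf hp3 h3
  rw [h.cubicDiscIdeal_integralClosure hL] at hD
  rw [(h.ncard_tracedOrders hL hp h3 hD).2, gTotRam]
  rcases hcases with ⟨hbt, hct⟩ | ⟨hbt, g, hg, c', hc', hcg⟩ | ⟨hct, g, hg, b', hb', hbg⟩
  · have hd₀ := le_disc_exponent_of_dvd hp h3 hbt hct hD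
    rw [sum_residueCount_of_totRam hp ha hb hc hd' hd (l := 0) (E := n + 1) le_rfl]
    · rw [rTotRam_of_le hd₀]
    · intro i j u hij
      exact iff_of_true (isHermiteTraced_of_dvd hbt hct i j) ⟨by omega, by omega, by simp⟩
  · obtain rfl := disc_exponent_of_fst hp ((pow_dvd_pow p (show g + 1 ≤ t from hg)).trans h3) ha
      ((pow_dvd_pow p (Nat.succ_le_of_lt hg)).trans hbt) hc' hcg hD
    rw [sum_residueCount_of_totRam hp ha hb hc hd' hd (l := 0) (E := n + 1 - (t - g)) (by omega)]
    · rw [rTotRam_three_mul hg]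
    · intro i j u hij
      rw [isHermiteTraced_iff_of_dvd_fst hp hbt hc' hcg]
      constructor
      · exact fun H => ⟨by omega, by omega, by simp⟩
      · rintro ⟨H, -⟩; omega
  · obtain rfl := disc_exponent_of_snd hp ((pow_dvd_pow p (show g + 1 ≤ t from hg)).trans h3)
      ((pow_dvd_pow p (Nat.succ_le_of_lt hg)).trans hct) hb' hbg hd' hd hD
    rw [sum_residueCount_of_totRam hp ha hb hc hd' hd (l := t - g) (E := n + 1) le_rfl]
    · rw [rTotRam_three_mul_add_one hg]
    · intro i j u hij
      rw [isHermiteTraced_iff_of_dvd_snd hp hct hb' hbg]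
      constructor
      · exact fun H => ⟨by omega, by omega, H.2⟩
      · rintro ⟨-, H, H'⟩; exact ⟨by omega, H'⟩

omit [Finite (IsLocalRing.ResidueField A)] in
lemma IsIndexFormBasis.disc_exponent_of_isTameForm (hL : Module.finrank K L = 3)
    (h : IsIndexFormBasis a b c d ω θ) (hp : Irreducible p) {s : ℕ} (hf : IsTameForm p a b c s)
    (hp3 : p ∣ 3) {d₀ : ℕ}
    (hD : cubicDiscIdeal A (integralClosure A L) = IsLocalRing.maximalIdeal A ^ d₀) : d₀ = s := by
  obtain ⟨hc, hb, hs, a', ha', ha⟩ := hf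
  rw [h.cubicDiscIdeal_integralClosure hL] at hD
  exact disc_exponent_of_isUnit hp hp3 hs ha' ha (hp3.trans hb) hc hD

theorem IsIndexFormBasis.ncard_of_isTameForm (hL : Module.finrank K L = 3)
    (h : IsIndexFormBasis a b c d ω θ) (hp : Irreducible p) {s : ℕ} (hf : IsTameForm p a b c s)
    (hp3 : p ∣ 3) {t n : ℕ} (h3 : p ^ t ∣ 3)
    (hD : cubicDiscIdeal A (integralClosure A L) = IsLocalRing.maximalIdeal A ^ s) :
    ((tracedOrders A K L (IsLocalRing.maximalIdeal A ^ (s + 2 * n))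
        (IsLocalRing.maximalIdeal A ^ t)).ncard : ℚ) =
      (if s = 0 then gInert (Nat.card (IsLocalRing.ResidueField A)) (s + 2 * n) t
        else gTotRam (Nat.card (IsLocalRing.ResidueField A)) s (s + 2 * n) t) +
      Nat.card (ResidueRoots a b c d) *
        gSR (Nat.card (IsLocalRing.ResidueField A)) (s + 2 * n) t := by
  obtain ⟨hc, hb, hs, a', ha', ha⟩ := hf
  rw [h.cubicDiscIdeal_integralClosure hL] at hD
  rw [(h.ncard_tracedOrders hL hp h3 hD).2,
    sum_residueCount_of_isUnit hp hp3 hs ha' ha (hp3.trans hb) hc (h3.trans hb), gInert, gTotRam,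
    gSR]
  have e1 : max t ((n + 2) / 3) = rSR (s + 2 * n) t := by
    rw [rSR]
    split_ifs <;> omega
  rw [e1]
  congr 1
  split_ifs with h0
  · rw [h0, rInert_zero_add]
  · rw [show s = 1 by omega, rTotRam_one_add]

end Count

/-! ### Primes of degree one and homomorphisms to the residue field -/

section DegreeOne

variable {A B : Type*} [CommRing A] [IsLocalRing A] [CommRing B] [Algebra A B]
  [Algebra.IsIntegral A B]

lemma inertiaDeg_eq_one_iff {P : Ideal B} (hP : P ∈ (IsLocalRing.maximalIdeal A).primesOver B) :
    P.inertiaDeg A = 1 ↔ ∀ x : B, ∃ r : A, x - algebraMap A B r ∈ P := by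
  obtain ⟨hP1, hP2⟩ := hP
  have : P.IsMaximal := Ideal.IsMaximal.of_liesOver_isMaximal P (IsLocalRing.maximalIdeal A)
  let : Field (A ⧸ IsLocalRing.maximalIdeal A) := Ideal.Quotient.field _
  rw [Ideal.inertiaDeg_eq_of_isMaximal (IsLocalRing.maximalIdeal A) P,
    ← Subalgebra.bot_eq_top_iff_finrank_eq_one, eq_comm, ← top_le_iff.trans eq_comm]
  constructor
  · intro H x
    obtain ⟨y, hy⟩ := Algebra.mem_bot.1 (H (Algebra.mem_top (x := Ideal.Quotient.mk P x)))
    obtain ⟨r, rfl⟩ := Ideal.Quotient.mk_surjective y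
    exact ⟨r, Ideal.Quotient.eq.1 hy.symm⟩
  · intro H y _
    obtain ⟨x, rfl⟩ := Ideal.Quotient.mk_surjective y
    obtain ⟨r, hr⟩ := H x
    exact Algebra.mem_bot.2 ⟨Ideal.Quotient.mk _ r, (Ideal.Quotient.eq.2 hr).symm⟩

/-- A homomorphism over `A` is determined by its kernel, a prime of degree one; conversely such a
prime `P` has `B / P` equal to the residue field of `A`. -/
lemma card_algHom_residueField :
    Nat.card (B →ₐ[A] IsLocalRing.ResidueField A) =
      Nat.card {P : (IsLocalRing.maximalIdeal A).primesOver B // P.1.inertiaDeg A = 1} := by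
  have hover : ∀ φ : B →ₐ[A] IsLocalRing.ResidueField A,
      RingHom.ker φ ∈ (IsLocalRing.maximalIdeal A).primesOver B := by
    refine fun φ => ⟨RingHom.ker_isPrime φ, ⟨?_⟩⟩
    ext r
    rw [Ideal.under, Ideal.mem_comap, RingHom.mem_ker, AlgHom.commutes]
    exact (IsLocalRing.residue_eq_zero_iff r).symm
  have hsurj : ∀ (φ : B →ₐ[A] IsLocalRing.ResidueField A) x, ∃ r : A,
      φ x = algebraMap A _ r := fun φ x => by
    obtain ⟨r, hr⟩ := IsLocalRing.residue_surjective (φ x)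
    exact ⟨r, hr.symm⟩
  refine Nat.card_congr (Equiv.ofBijective (fun φ => ⟨⟨RingHom.ker φ, hover φ⟩,
    (inertiaDeg_eq_one_iff (hover φ)).2 fun x => ?_⟩) ⟨?_, ?_⟩)
  · obtain ⟨r, hr⟩ := hsurj φ x
    exact ⟨r, by rw [RingHom.mem_ker, map_sub, hr, AlgHom.commutes, sub_self]⟩
  · intro φ ψ e
    have e' : RingHom.ker φ = RingHom.ker ψ := congrArg (fun P => P.1.1) e
    ext x
    obtain ⟨r, hr⟩ := hsurj φ x
    have : x - algebraMap A B r ∈ RingHom.ker φ := by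
      rw [RingHom.mem_ker, map_sub, hr, AlgHom.commutes, sub_self]
    rw [e', RingHom.mem_ker, map_sub, AlgHom.commutes, sub_eq_zero] at this
    rw [hr, this]
  · rintro ⟨⟨P, hP⟩, hdeg⟩
    have hx := (inertiaDeg_eq_one_iff hP).1 hdeg
    obtain ⟨hP1, hP2⟩ := id hP
    have : P.IsMaximal := Ideal.IsMaximal.of_liesOver_isMaximal P (IsLocalRing.maximalIdeal A)
    let : Field (A ⧸ IsLocalRing.maximalIdeal A) := Ideal.Quotient.field _
    have hbij : Function.Bijective
        (Algebra.ofId (A ⧸ IsLocalRing.maximalIdeal A) (B ⧸ P)) := by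
      refine ⟨RingHom.injective _, fun y => ?_⟩
      obtain ⟨x, rfl⟩ := Ideal.Quotient.mk_surjective y
      obtain ⟨r, hr⟩ := hx x
      exact ⟨Ideal.Quotient.mk _ r, (Ideal.Quotient.eq.2 hr).symm⟩
    let E := (AlgEquiv.ofBijective _ hbij).symm.restrictScalars A
    let φ : B →ₐ[A] IsLocalRing.ResidueField A :=
      (E : (B ⧸ P) →ₐ[A] (A ⧸ IsLocalRing.maximalIdeal A)).comp (Ideal.Quotient.mkₐ A P)
    refine ⟨φ, Subtype.ext (Subtype.ext ?_)⟩
    ext x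
    rw [RingHom.mem_ker]
    change E (Ideal.Quotient.mk P x) = 0 ↔ _
    rw [map_eq_zero_iff E E.injective, Ideal.Quotient.eq_zero_iff_mem]

/-- The number of primes of residue degree one in a splitting type. -/
def CubicSplittingType.degreeOneCount : CubicSplittingType → ℕ
  | .totRam => 1
  | .partRam => 2
  | .inert => 0
  | .partSplit => 1
  | .split => 3

end DegreeOne

lemma HasSplittingType.card_algHom {A L : Type*} [CommRing A] [IsLocalRing A] [CommRing L]
    [Algebra A L] {σ : CubicSplittingType} (hσ : HasSplittingType A L σ) :
    Nat.card (integralClosure A L →ₐ[A] IsLocalRing.ResidueField A) = σ.degreeOneCount := by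
  obtain ⟨P, hP⟩ := hσ
  rw [card_algHom_residueField]
  have e : {i : Fin σ.pattern.length // (σ.pattern.get i).2 = 1} ≃
      {P : (IsLocalRing.maximalIdeal A).primesOver (integralClosure A L) //
        P.1.inertiaDeg A = 1} :=
    P.subtypeEquiv fun i => by rw [← hP i]
  rw [← Nat.card_congr e, Nat.card_eq_fintype_card]
  cases σ <;> rfl

/-! ### Homomorphisms as solutions of the multiplication table -/

section Table

variable {A L : Type*} [CommRing A] [CommRing L] [Algebra A L] {a b c d : A} {ω θ : L}

/-- Homomorphisms from the integral closure to `k` are solutions of the multiplication table. -/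
lemma IsIndexFormBasis.card_algHom (h : IsIndexFormBasis a b c d ω θ) (k : Type*) [CommRing k]
    [Algebra A k] :
    Nat.card (integralClosure A L →ₐ[A] k) = Nat.card {x : k × k //
      x.1 * x.1 = algebraMap A k (-(a * c)) + algebraMap A k b * x.1 - algebraMap A k a * x.2 ∧
      x.1 * x.2 = algebraMap A k (-(a * d)) ∧
      x.2 * x.2 = algebraMap A k (-(b * d)) + algebraMap A k d * x.1 - algebraMap A k c * x.2} := by
  let W : integralClosure A L := ⟨ω, h.isIntegral_fst⟩
  let Z : integralClosure A L := ⟨θ, h.isIntegral_snd⟩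
  have hcomb : ∀ z : integralClosure A L, ∃ r x y : A,
      z = algebraMap A _ r + algebraMap A _ x * W + algebraMap A _ y * Z := by
    rintro ⟨z, hz⟩
    obtain ⟨r, x, y, rfl⟩ := h.exists_eq z hz
    exact ⟨r, x, y, Subtype.ext rfl⟩
  have h1 : W * W = algebraMap A _ (-(a * c)) + algebraMap A _ b * W - algebraMap A _ a * Z :=
    Subtype.ext h.fst_sq
  have h2 : W * Z = algebraMap A _ (-(a * d)) := Subtype.ext h.fst_mul_snd
  have h3 : Z * Z = algebraMap A _ (-(b * d)) + algebraMap A _ d * W - algebraMap A _ c * Z :=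
    Subtype.ext h.snd_sq
  refine Nat.card_congr (Equiv.ofBijective (fun φ => ⟨(φ W, φ Z), ?_, ?_, ?_⟩) ⟨?_, ?_⟩)
  · have := congrArg φ h1
    simpa only [map_mul, map_add, map_sub, AlgHom.commutes] using this
  · have := congrArg φ h2
    simpa only [map_mul, map_add, map_sub, AlgHom.commutes] using this
  · have := congrArg φ h3
    simpa only [map_mul, map_add, map_sub, AlgHom.commutes] using this
  · intro φ ψ e
    have e' := congrArg Subtype.val e
    simp only [Prod.mk.injEq] at e'
    ext z
    obtain ⟨r, x, y, rfl⟩ := hcomb z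
    simp only [map_mul, map_add, AlgHom.commutes, e'.1, e'.2]
  · rintro ⟨⟨s, t⟩, g1, g2, g3⟩
    obtain ⟨w, hw⟩ := h.exists_basis_integralClosure
    have hw0 : w 0 = 1 := Subtype.ext (hw 0)
    have hw1 : w 1 = W := Subtype.ext (hw 1)
    have hw2 : w 2 = Z := Subtype.ext (hw 2)
    let f : integralClosure A L →ₗ[A] k := w.constr A ![1, s, t]
    have f0 : f 1 = 1 := by rw [← hw0]; simp [f]
    have f1 : f W = s := by rw [← hw1]; simp [f]
    have f2 : f Z = t := by rw [← hw2]; simp [f]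
    have hf : ∀ r x y : A, f (algebraMap A _ r + algebraMap A _ x * W + algebraMap A _ y * Z) =
        algebraMap A k r + algebraMap A k x * s + algebraMap A k y * t := by
      intro r x y
      rw [Algebra.algebraMap_eq_smul_one, ← Algebra.smul_def, ← Algebra.smul_def, map_add, map_add,
        map_smul, map_smul, map_smul, f0, f1, f2, Algebra.smul_def, Algebra.smul_def,
        Algebra.smul_def, mul_one]
    refine ⟨AlgHom.ofLinearMap f f0 ?_, ?_⟩
    · intro z z'
      obtain ⟨r, x, y, rfl⟩ := hcomb z
      obtain ⟨r', x', y', rfl⟩ := hcomb z'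
      have hmul : (algebraMap A _ r + algebraMap A _ x * W + algebraMap A _ y * Z) *
          (algebraMap A _ r' + algebraMap A _ x' * W + algebraMap A _ y' * Z) =
          algebraMap A (integralClosure A L)
          (r * r' - a * c * (x * x') - a * d * (x * y' + y * x') - b * d * (y * y')) +
          algebraMap A _ (r * x' + x * r' + b * (x * x') + d * (y * y')) * W +
          algebraMap A _ (r * y' + y * r' - a * (x * x') - c * (y * y')) * Z :=
        Subtype.ext (h.comb_mul_comb r x y r' x' y')
      rw [hmul, hf, hf, hf]
      simp only [map_mul, map_add, map_sub, map_neg] at g1 g2 g3 ⊢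
      linear_combination -algebraMap A k x * algebraMap A k x' * g1 -
        (algebraMap A k x * algebraMap A k y' + algebraMap A k y * algebraMap A k x') * g2 -
        algebraMap A k y * algebraMap A k y' * g3
    · exact Subtype.ext (Prod.ext f1 f2)

end Table

/-! ### Cubic polynomials over a field -/

section Roots

variable {k : Type*} [Field k]

/-- A cubic polynomial without quadratic term does not have exactly two roots in a field of
characteristic three. -/
lemma card_roots_ne_two [CharP k 3] (a c d : k) :
    Nat.card {z : k // a * z ^ 3 + 0 * z ^ 2 + c * z + d = 0} ≠ 2 := by
  have h3 : (3 : k) = 0 := by exact_mod_cast CharP.cast_eq_zero k 3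
  intro H
  obtain ⟨⟨x, hx⟩, ⟨y, hy⟩, hxy, huniv⟩ := Nat.card_eq_two_iff.1 H
  have hne : x - y ≠ 0 := fun e => hxy (Subtype.ext (sub_eq_zero.1 e))
  have key : a * (x ^ 2 + x * y + y ^ 2) + c = 0 :=
    mul_left_cancel₀ hne (by linear_combination hx - hy)
  -- The roots sum to zero, so `-(x + y)` is a third root; in characteristic 3, its equality with
  -- `x` or `y` would give `x = y`.
  have hz : a * (-(x + y)) ^ 3 + 0 * (-(x + y)) ^ 2 + c * (-(x + y)) + d = 0 := by
    linear_combination hx - (2 * x + y) * key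
  have : (⟨-(x + y), hz⟩ : {z : k // a * z ^ 3 + 0 * z ^ 2 + c * z + d = 0}) ∈
      ({⟨x, hx⟩, ⟨y, hy⟩} : Set _) := huniv ▸ Set.mem_univ _
  simp only [Set.mem_insert_iff, Set.mem_singleton_iff, Subtype.mk.injEq] at this
  rcases this with e | e
  · exact hne (by linear_combination e + x * h3)
  · exact hne (by linear_combination -e - y * h3)

/-- If the leading coefficient does not vanish, solutions of the multiplication table of a
depressed cubic form are its roots. -/
lemma card_table_solutions {a c d : k} (ha : a ≠ 0) :
    Nat.card {x : k × k // x.1 * x.1 = -(a * c) + 0 * x.1 - a * x.2 ∧ x.1 * x.2 = -(a * d) ∧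
      x.2 * x.2 = -(0 * d) + d * x.1 - c * x.2} =
    Nat.card {z : k // a * z ^ 3 + 0 * z ^ 2 + c * z + d = 0} := by
  -- Once the first coordinate is `-a z`, the equation for its square forces the second to be `-a z²
  -- - c`.
  refine (Nat.card_congr (Equiv.ofBijective (fun z => ⟨(-a * z.1, -a * z.1 ^ 2 - c),
    by ring, by linear_combination a * z.2, by linear_combination a * z.1 * z.2⟩) ⟨?_, ?_⟩)).symm
  · intro z w e
    have := congrArg (fun x => x.1.1) e
    exact Subtype.ext (mul_left_cancel₀ (neg_ne_zero.2 ha) this)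
  · rintro ⟨⟨s, t⟩, h1, h2, h3⟩
    have e1 : -a * (-s / a) = s := by field_simp
    have e2 : -a * (-s / a) ^ 2 - c = t := by
      apply mul_left_cancel₀ ha
      dsimp only at h1
      field_simp
      linear_combination -h1
    refine ⟨⟨-s / a, ?_⟩, Subtype.ext (Prod.ext e1 e2)⟩
    have e3 : a * (-s / a) ^ 3 + 0 * (-s / a) ^ 2 + c * (-s / a) + d =
        (-(-a * (-s / a)) * (-a * (-s / a) ^ 2 - c)) * (-1 / a) + d := by
      field_simp
      ring
    rw [e3, e1, e2]
    dsimp only at h2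
    field_simp
    linear_combination h2

/-- The first coordinate squares to zero, hence vanishes, and the second satisfies `t (t + c) = 0`.
The polynomial `c z + d` sees only one of these points; the other is the double root of the form at
infinity. -/
lemma card_table_solutions_zero {c d : k} (hc : c ≠ 0) :
    Nat.card {x : k × k // x.1 * x.1 = -(0 * c) + 0 * x.1 - 0 * x.2 ∧ x.1 * x.2 = -(0 * d) ∧
      x.2 * x.2 = -(0 * d) + d * x.1 - c * x.2} = 2 := by
  rw [Nat.card_eq_two_iff]
  refine ⟨⟨(0, 0), by simp⟩, ⟨(0, -c), by simp⟩, ?_, ?_⟩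
  · intro e
    have := congrArg (fun x => x.1.2) e
    exact hc (by simpa using this.symm)
  · refine Set.eq_univ_of_forall ?_
    rintro ⟨⟨s, t⟩, h1, h2, h3⟩
    dsimp only at h1 h2 h3
    have hs : s = 0 := mul_self_eq_zero.1 (by linear_combination h1)
    subst hs
    have : t * (t + c) = 0 := by linear_combination h3
    rcases mul_eq_zero.1 this with h | h
    · left; exact Subtype.ext (Prod.ext rfl h)
    · right; exact Subtype.ext (Prod.ext rfl (eq_neg_of_add_eq_zero_left h))

lemma card_linear_roots {b c d : k} (hb : b = 0) (hc : c ≠ 0) :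
    Nat.card {z : k // 0 * z ^ 3 + b * z ^ 2 + c * z + d = 0} = 1 := by
  subst hb
  rw [Nat.card_eq_one_iff_unique]
  refine ⟨⟨fun z w => Subtype.ext ?_⟩, ⟨⟨-d / c, ?_⟩⟩⟩
  · exact mul_left_cancel₀ hc (by linear_combination z.2 - w.2)
  · field_simp; ring

end Roots

/-! ### Reading the splitting type from the form -/

section SplittingType

variable {A K L : Type*} [CommRing A] [IsDomain A] [IsDiscreteValuationRing A]
  [Field K] [Algebra A K] [IsFractionRing A K]
  [CommRing L] [Algebra K L] [Algebra A L] [IsScalarTower A K L] {p a b c d : A} {ω θ : L}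
  {σ : CubicSplittingType}

/-- The cubic equations make `ω³` and `θ³` multiples of `p`, so every prime above `p` contains `ω`
and `θ`. There is then at most one such prime, with residue degree 1, and only one pattern allows
this. -/
lemma IsIndexFormBasis.eq_totRam (h : IsIndexFormBasis a b c d ω θ) (hp : Irreducible p)
    (hf : IsTotRamForm p a b c d) (hσ : HasSplittingType A L σ) : σ = .totRam := by
  obtain ⟨-, hb, hc, d', -, hd⟩ := hf
  have hd : p ∣ d := ⟨d', hd⟩
  let W : integralClosure A L := ⟨ω, h.isIntegral_fst⟩
  let Z : integralClosure A L := ⟨θ, h.isIntegral_snd⟩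
  have hcomb : ∀ z : integralClosure A L, ∃ r x y : A,
      z = algebraMap A _ r + algebraMap A _ x * W + algebraMap A _ y * Z := by
    rintro ⟨z, hz⟩
    obtain ⟨r, x, y, rfl⟩ := h.exists_eq z hz
    exact ⟨r, x, y, Subtype.ext rfl⟩
  have key : ∀ P ∈ (IsLocalRing.maximalIdeal A).primesOver (integralClosure A L),
      ∀ r x y : A, (algebraMap A _ r + algebraMap A _ x * W + algebraMap A _ y * Z) -
        algebraMap A _ r ∈ P := by
    rintro P ⟨hP1, hP2⟩
    have hmem : ∀ {x}, p ∣ x → algebraMap A (integralClosure A L) x ∈ P := fun {x} hx => by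
      rw [← Ideal.mem_of_liesOver P (IsLocalRing.maximalIdeal A), hp.maximalIdeal_eq]
      exact Ideal.mem_span_singleton.2 hx
    have hW : W ∈ P := by
      refine hP1.mem_of_pow_mem 3 ?_
      have e : W ^ 3 = algebraMap A _ b * W ^ 2 - algebraMap A _ (a * c) * W
          + algebraMap A _ (a ^ 2 * d) := Subtype.ext (by
        have := h.fst_cubic
        change ω ^ 3 = algebraMap A L b * ω ^ 2 - algebraMap A L (a * c) * ω
          + algebraMap A L (a ^ 2 * d)
        linear_combination this)
      rw [e]
      exact P.add_mem (P.sub_mem (P.mul_mem_right _ (hmem hb))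
        (P.mul_mem_right _ (hmem (hc.mul_left _)))) (hmem (hd.mul_left _))
    have hZ : Z ∈ P := by
      refine hP1.mem_of_pow_mem 3 ?_
      have e : Z ^ 3 = algebraMap A _ (-c) * Z ^ 2 - algebraMap A _ (-d * -b) * Z
          + algebraMap A _ ((-d) ^ 2 * -a) := Subtype.ext (by
        have := h.swap.fst_cubic
        change θ ^ 3 = algebraMap A L (-c) * θ ^ 2 - algebraMap A L (-d * -b) * θ
          + algebraMap A L ((-d) ^ 2 * -a)
        linear_combination this)
      rw [e]
      exact P.add_mem (P.sub_mem (P.mul_mem_right _ (hmem hc.neg_right))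
        (P.mul_mem_right _ (hmem (hb.neg_right.mul_left _))))
        (hmem ((dvd_pow hd.neg_right two_ne_zero).mul_right _))
    intro r x y
    rw [add_assoc, add_sub_cancel_left]
    exact P.add_mem (P.mul_mem_left _ hW) (P.mul_mem_left _ hZ)
  have hle : ∀ P ∈ (IsLocalRing.maximalIdeal A).primesOver (integralClosure A L),
      ∀ Q ∈ (IsLocalRing.maximalIdeal A).primesOver (integralClosure A L), P ≤ Q := by
    intro P hP Q hQ z hz
    obtain ⟨r, x, y, rfl⟩ := hcomb z
    have h1 := P.sub_mem hz (key P hP r x y)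
    rw [sub_sub_cancel] at h1
    have := hP.2
    have := hQ.2
    rw [← Ideal.mem_of_liesOver P (IsLocalRing.maximalIdeal A),
      Ideal.mem_of_liesOver Q (IsLocalRing.maximalIdeal A)] at h1
    have h2 := Q.add_mem (key Q hQ r x y) h1
    rwa [sub_add_cancel] at h2
  have hdeg : ∀ P ∈ (IsLocalRing.maximalIdeal A).primesOver (integralClosure A L),
      P.inertiaDeg A = 1 := by
    intro P hP
    rw [inertiaDeg_eq_one_iff hP]
    intro z
    obtain ⟨r, x, y, rfl⟩ := hcomb z
    exact ⟨r, key P hP r x y⟩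
  obtain ⟨P, hP⟩ := hσ
  have hsub : ∀ i j, i = j := fun i j => P.injective (Subtype.ext (le_antisymm
    (hle _ (P i).2 _ (P j).2) (hle _ (P j).2 _ (P i).2)))
  have hone : ∀ i, (σ.pattern.get i).2 = 1 := fun i => by
    rw [← hP i]
    exact hdeg _ (P i).2
  cases σ with
  | totRam => rfl
  | partRam => exact absurd (congrArg Fin.val (hsub ⟨0, by decide⟩ ⟨1, by decide⟩)) (by decide)
  | inert => exact absurd (hone ⟨0, by decide⟩) (by decide)
  | partSplit => exact absurd (congrArg Fin.val (hsub ⟨0, by decide⟩ ⟨1, by decide⟩)) (by decide)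
  | split => exact absurd (congrArg Fin.val (hsub ⟨0, by decide⟩ ⟨1, by decide⟩)) (by decide)

include K in
-- With a single prime, of degree one, some `θ - r` is nilpotent modulo the maximal ideal, and so
-- its trace vanishes there. But this trace is `-c - 3r`, a unit.
lemma IsIndexFormBasis.ne_totRam (hL : Module.finrank K L = 3)
    (h : IsIndexFormBasis a b c d ω θ) (hp : Irreducible p) (hp3 : p ∣ 3)
    (hc : IsUnit c) (hσ : HasSplittingType A L σ) : σ ≠ .totRam := by
  rintro rfl
  obtain ⟨P, hP⟩ := hσ
  let Z : integralClosure A L := ⟨θ, h.isIntegral_snd⟩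
  obtain ⟨w, hw⟩ := h.exists_basis_integralClosure
  have : Module.Finite A (integralClosure A L) := Module.Finite.of_basis w
  have : Module.Free A (integralClosure A L) := Module.Free.of_basis w
  let i₀ : Fin CubicSplittingType.totRam.pattern.length := ⟨0, by decide⟩
  have huniq : ∀ Q ∈ (IsLocalRing.maximalIdeal A).primesOver (integralClosure A L),
      Q = (P i₀).1 := fun Q hQ => by
    obtain ⟨i, hi⟩ := P.surjective ⟨Q, hQ⟩
    obtain rfl : i = i₀ := Fin.ext (Nat.lt_one_iff.1 i.2)
    exact (congrArg Subtype.val hi).symm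
  obtain ⟨r, hr⟩ := (inertiaDeg_eq_one_iff (P i₀).2).1 (congrArg Prod.snd (hP i₀)) Z
  have hrad : Z - algebraMap A _ r ∈ (Ideal.map (algebraMap A (integralClosure A L))
      (IsLocalRing.maximalIdeal A)).radical := by
    rw [Ideal.radical_eq_sInf, Submodule.mem_sInf]
    rintro Q ⟨hQ, hQp⟩
    rw [huniq Q ⟨hQp, ⟨?_⟩⟩]
    · exact hr
    · exact (IsLocalRing.maximalIdeal.isMaximal A).eq_of_le
        (Ideal.comap_ne_top _ hQp.ne_top) (Ideal.map_le_iff_le_comap.1 hQ)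
  obtain ⟨N, hN⟩ := hrad
  have hnil : IsNilpotent (Ideal.Quotient.mk (Ideal.map (algebraMap A (integralClosure A L))
      (IsLocalRing.maximalIdeal A)) (Z - algebraMap A _ r)) :=
    ⟨N, by rw [← map_pow]; exact Ideal.Quotient.eq_zero_iff_mem.2 hN⟩
  have htr := LinearMap.isNilpotent_trace_of_isNilpotent (hnil.map
    (Algebra.lmul (A ⧸ IsLocalRing.maximalIdeal A) _))
  rw [← Algebra.trace_apply, Algebra.trace_quotient_mk] at htr
  have h0 := htr.eq_zero
  rw [Ideal.Quotient.eq_zero_iff_mem] at h0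
  have e : Algebra.trace A (integralClosure A L) (Z - algebraMap A _ r) = 3 * -r + b * 0 - c * 1 := by
    apply IsFractionRing.injective A K
    rw [algebraMap_trace_subalgebra hL w, ← h.trace_comb hL]
    congr 1
    change θ - algebraMap A L r = _
    simp only [map_neg, map_zero, map_one]
    ring
  rw [e] at h0
  obtain ⟨x, hx⟩ := hp3
  refine h0 ?_
  have := hc.neg.add_irreducible_mul hp (-(x * r))
  convert this using 1
  linear_combination -r * hx

variable [CharP (IsLocalRing.ResidueField A) 3]

include K in
-- The number of degree-one primes separates all types except `1³` and `12`, and `ne_totRam`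
-- excludes `1³`. For `s = 0` that number is the number of roots, which is never 2; for `s = 1` it
-- is 2, though only one root is finite.
lemma IsIndexFormBasis.splittingType_of_isTameForm (hL : Module.finrank K L = 3)
    (h : IsIndexFormBasis a b c d ω θ) (hp : Irreducible p) (hp3 : p ∣ 3) {s : ℕ}
    (hf : IsTameForm p a b c s) (hσ : HasSplittingType A L σ) :
    (s = 1 ∧ σ = .partRam ∧ Nat.card (ResidueRoots a b c d) = 1) ∨
    (s = 0 ∧ σ = .inert ∧ Nat.card (ResidueRoots a b c d) = 0) ∨
    (s = 0 ∧ σ = .partSplit ∧ Nat.card (ResidueRoots a b c d) = 1) ∨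
    (s = 0 ∧ σ = .split ∧ Nat.card (ResidueRoots a b c d) = 3) := by
  obtain ⟨hc, hb, hs, a', ha', ha⟩ := hf
  have hne := h.ne_totRam hL hp hp3 hc hσ
  have hcard := hσ.card_algHom
  rw [h.card_algHom (IsLocalRing.ResidueField A)] at hcard
  have hc0 : IsLocalRing.residue A c ≠ 0 := by
    rw [Ne, residue_eq_zero_iff_dvd hp]
    exact fun H => hp.not_isUnit (isUnit_of_dvd_unit H hc)
  have hb0 : IsLocalRing.residue A b = 0 := (residue_eq_zero_iff_dvd hp).2 (hp3.trans hb)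
  simp only [map_neg, map_mul, IsLocalRing.ResidueField.algebraMap_eq, hb0] at hcard
  rw [ResidueRoots, hb0]
  interval_cases s
  · rw [pow_zero, one_mul] at ha
    have ha0 : IsLocalRing.residue A a ≠ 0 := by
      rw [Ne, residue_eq_zero_iff_dvd hp, ha]
      exact fun H => hp.not_isUnit (isUnit_of_dvd_unit H ha')
    rw [card_table_solutions ha0] at hcard
    have h2 := card_roots_ne_two (IsLocalRing.residue A a) (IsLocalRing.residue A c)
      (IsLocalRing.residue A d)
    rw [hcard] at h2 ⊢
    cases σ <;> simp_all [CubicSplittingType.degreeOneCount]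
  · have ha0 : IsLocalRing.residue A a = 0 :=
      (residue_eq_zero_iff_dvd hp).2 ⟨a', by rw [ha, pow_one]⟩
    rw [ha0, card_table_solutions_zero hc0] at hcard
    rw [ha0, card_linear_roots rfl hc0]
    cases σ <;> simp_all [CubicSplittingType.degreeOneCount]

end SplittingType

/-! ### Assembly -/

section Main

variable {A K L : Type*} [CommRing A] [IsDomain A] [IsDiscreteValuationRing A]
  [Finite (IsLocalRing.ResidueField A)] [CharP (IsLocalRing.ResidueField A) 3]
  [Field K] [Algebra A K] [IsFractionRing A K]
  [CommRing L] [Algebra K L] [Algebra A L] [IsScalarTower A K L] {σ : CubicSplittingType}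

/-- The count of traced orders over a discrete valuation ring with finite residue field of
characteristic three. -/
theorem ncard_tracedOrders_eq (hL : Module.finrank K L = 3) {t d₀ n : ℕ}
    (h3 : (3 : A) ∈ IsLocalRing.maximalIdeal A ^ t)
    (hD : cubicDiscIdeal A (integralClosure A L) = IsLocalRing.maximalIdeal A ^ d₀)
    (hσ : HasSplittingType A L σ) :
    (tracedOrders A K L (IsLocalRing.maximalIdeal A ^ (d₀ + 2 * n))
        (IsLocalRing.maximalIdeal A ^ t)).Finite ∧
    ((tracedOrders A K L (IsLocalRing.maximalIdeal A ^ (d₀ + 2 * n))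
        (IsLocalRing.maximalIdeal A ^ t)).ncard : ℚ) =
      tracedOrderCount (Nat.card (IsLocalRing.ResidueField A)) d₀ (d₀ + 2 * n) t σ := by
  obtain ⟨p, hp⟩ := IsDiscreteValuationRing.exists_irreducible A
  have hp3 : p ∣ 3 := by
    rw [← residue_eq_zero_iff_dvd hp, map_ofNat]
    exact_mod_cast CharP.cast_eq_zero (IsLocalRing.ResidueField A) 3
  rw [hp.maximalIdeal_eq, Ideal.span_singleton_pow, Ideal.mem_span_singleton] at h3
  obtain ⟨a, b, c, d, ω, θ, h⟩ := exists_isIndexFormBasis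
    (IsDiscreteValuationRing.not_isField A) hL (by
      rw [hD]
      exact pow_ne_zero _ (IsDiscreteValuationRing.not_a_field A))
  refine ⟨(h.ncard_tracedOrders hL hp h3 ((h.cubicDiscIdeal_integralClosure hL).symm.trans hD)).1,
    ?_⟩
  rcases h.exists_normalForm (K := K) hp hp3 with
    ⟨a, b, c, d, ω, θ, h, hf⟩ | ⟨a, b, c, d, ω, θ, s, h, hf⟩
  · obtain rfl := h.eq_totRam hp hf hσ
    exact h.ncard_of_isTotRamForm hL hp hf hp3 h3 hD
  · obtain rfl := h.disc_exponent_of_isTameForm hL hp hf hp3 hD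
    rw [h.ncard_of_isTameForm hL hp hf hp3 h3 hD]
    rcases h.splittingType_of_isTameForm hL hp hp3 hf hσ with
      ⟨rfl, rfl, e⟩ | ⟨rfl, rfl, e⟩ | ⟨rfl, rfl, e⟩ | ⟨rfl, rfl, e⟩ <;>
    simp [e, tracedOrderCount]

end Main

theorem mainTheorem9 {K : Type*} [Field K] [ValuativeRel K] [TopologicalSpace K]
    [IsNonarchimedeanLocalField K] [CharZero K] [CharP 𝓀[K] 3]
    {L : Type*} [CommRing L] [Algebra K L] [Algebra.Etale K L] (hL : Module.finrank K L = 3)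
    (e : ℕ) (he : Ideal.span {(3 : 𝒪[K])} = 𝓂[K] ^ e)
    (d₀ : ℕ) (hd₀ : cubicDiscIdeal 𝒪[K] (integralClosure 𝒪[K] L) = 𝓂[K] ^ d₀)
    (d t : ℕ) (hd : d₀ ≤ d) (hpar : d ≡ d₀ [MOD 2]) (ht : t ≤ e)
    (σ : CubicSplittingType) (hσ : HasSplittingType 𝒪[K] L σ) :
    (tracedOrders 𝒪[K] K L (𝓂[K] ^ d) (𝓂[K] ^ t)).Finite ∧
      ((tracedOrders 𝒪[K] K L (𝓂[K] ^ d) (𝓂[K] ^ t)).ncard : ℚ) =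
        tracedOrderCount (Nat.card 𝓀[K]) d₀ d t σ := by
  obtain ⟨n, rfl⟩ : ∃ n, d = d₀ + 2 * n := ⟨(d - d₀) / 2, by
    have : d % 2 = d₀ % 2 := hpar
    omega⟩
  have h3 : (3 : 𝒪[K]) ∈ 𝓂[K] ^ t :=
    Ideal.pow_le_pow_right ht (he ▸ Ideal.mem_span_singleton_self _)
  exact ncard_tracedOrders_eq hL h3 hd₀ hσ
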